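/- Let $n\ge 1$ and let $\mathcal A$ be a von Neumann algebra (more generally a unital $C^*$-algebra) with a tracial state $\tau$ (a linear functional with $\tau(1)=1$, $\tau(a^*a)\ge 0$, $\tau(ab)=\tau(ba)$). Let $(\mathcal F_t)_{t\ge 0}$ be an increasing family of unital $*$-subalgebras of $\mathcal A$, and let $W=(W_t)_{t\ge0}$ be an $n\times n$ matrix of free Brownian noise: $W_t\in M_n(\mathcal A)$ is selfadjoint with entries in $\mathcal F_t$, $W_0=0$, and for $0\le s\le t$ the entries of $W_t-W_s$ are jointly $*$-free from $\mathcal F_s$ and form a centred semicircular family with covariance $\tau\big((W_t-W_s)_{ij}(W_t-W_s)_{kl}\big)=(t-s)\,\delta_{il}\delta_{jk}$. Let $\mathsf U^{\langle n\rangle}$ be the free unitary Brownian motion of dimension $n$ driven by $W$: a process $\mathsf U^{\langle n\rangle}(t)\in M_n(\mathcal A)$, $t\ge 0$, with entries in $\mathcal F_t$ and norm continuous in $t$, with $\mathsf U^{\langle n\rangle}(0)=1$ and $$\mathrm d\mathsf U^{\langle n\rangle}(t)=\frac{\mathsf i}{\sqrt n}\,\mathrm dW_t\,\mathsf U^{\langle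 n\rangle}(t)-\frac12\,\mathsf U^{\langle n\rangle}(t)\,\mathrm dt ,$$ where $\int_0^t \mathrm dW_s\,\mathsf U^{\langle n\rangle}(s)$ is the Itô integral (the entrywise $L^2(\tau)$-limit of the Riemann sums $\sum_k (W_{p_{k+1}}-W_{p_k})\,\mathsf U^{\langle n\rangle}(p_k)$ as the mesh of the partition tends to $0$). Let $\mathcal O\langle n\rangle$ be the dual Voiculescu group, that is, the unital $*$-algebra generated by $u_{ij}$, $1\le i,j\le n$, with the relations $\sum_k u_{ik}u_{jk}^*=\delta_{ij}=\sum_k u_{ki}^*u_{kj}$. A unitary matrix $M\in M_n(\mathcal A)$ induces a morphism of $*$-algebras $\mathcal O\langle n\rangle\to\mathcal A$, $u_{ij}\mapsto M_{ij}$, whose value on $u$ is denoted $M(u)$. Let $t\ge 0$ and let $V\in M_n(\mathcal A)$ be unitary, such that the $*$-subalgebra generated by the entries of $V$ is free from the $*$-subalgebra generated by the entries of $\mathsf U^{\langle n\rangle}(t)$. Put $\mathsf U^{\langle n\rangle V}(t)=V\,\mathsf U^{\langle n\rangle}(t)\,V^{-1}$. Then, if $\tau$ is faithful, $\mathsf U^{\langle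 n\rangle}(t)$ is unitary; and, whenever $\mathsf U^{\langle n\rangle}(t)$ is unitary, $$\tau\big(\mathsf U^{\langle n\rangle V}(t)(u)\big)=\tau\big(\mathsf U^{\langle n\rangle}(t)(u)\big)\qquad\text{for all } u\in\mathcal O\langle n\rangle .$$ -/

import Mathlib

open scoped ComplexOrder

noncomputable section

/-! ### The dual Voiculescu group `O⟨n⟩` -/

namespace DualVoiculescu

/-- Formal generators: `(i, j, false)` stands for `u_{ij}` and `(i, j, true)` for `u_{ij}^*`. -/
abbrev Gen (n : ℕ) : Type := Fin n × Fin n × Bool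

/-- The defining relations `∑ₖ u_{ik} u_{jk}^* = δ_{ij}` and `∑ₖ u_{ki}^* u_{kj} = δ_{ij}`. -/
inductive Rel (n : ℕ) : FreeAlgebra ℂ (Gen n) → FreeAlgebra ℂ (Gen n) → Prop
  | left (i j : Fin n) :
      Rel n (∑ k, FreeAlgebra.ι ℂ ((i, k, false) : Gen n) * FreeAlgebra.ι ℂ ((j, k, true) : Gen n))
        (if i = j then 1 else 0)
  | right (i j : Fin n) :
      Rel n (∑ k, FreeAlgebra.ι ℂ ((k, i, true) : Gen n) * FreeAlgebra.ι ℂ ((k, j, false) : Gen n))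
        (if i = j then 1 else 0)

end DualVoiculescu

/-- The unital complex algebra `O⟨n⟩` generated by `u_{ij}, u_{ij}^*` subject to the unitarity
relations. Its involution is the instance further below. -/
def DualVoiculescu (n : ℕ) : Type := RingQuot (DualVoiculescu.Rel n)

namespace DualVoiculescu

variable {n : ℕ}

instance : Ring (DualVoiculescu n) := inferInstanceAs (Ring (RingQuot (Rel n)))

instance : Algebra ℂ (DualVoiculescu n) := inferInstanceAs (Algebra ℂ (RingQuot (Rel n)))

/-- The class of a formal generator. -/
def gen (x : Gen n) : DualVoiculescu n := RingQuot.mkAlgHom ℂ (Rel n) (FreeAlgebra.ι ℂ x)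

/-- The generator `u_{ij}`. -/
def u (i j : Fin n) : DualVoiculescu n := gen (i, j, false)

/-- Algebra homomorphisms out of `O⟨n⟩` from the images of the generators. -/
def liftAlg {B : Type*} [Ring B] [Algebra ℂ B] (f : Gen n → B)
    (h₁ : ∀ i j, ∑ k, f (i, k, false) * f (j, k, true) = if i = j then 1 else 0)
    (h₂ : ∀ i j, ∑ k, f (k, i, true) * f (k, j, false) = if i = j then 1 else 0) :
    DualVoiculescu n →ₐ[ℂ] B :=
  RingQuot.liftAlgHom ℂ (s := Rel n) ⟨FreeAlgebra.lift ℂ f, by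
    rintro _ _ (⟨i, j⟩ | ⟨i, j⟩)
    · simp only [map_sum, map_mul, FreeAlgebra.lift_ι_apply, h₁]
      split_ifs <;> simp
    · simp only [map_sum, map_mul, FreeAlgebra.lift_ι_apply, h₂]
      split_ifs <;> simp⟩

theorem liftAlg_gen {B : Type*} [Ring B] [Algebra ℂ B] (f : Gen n → B) (h₁) (h₂) (x : Gen n) :
    liftAlg f h₁ h₂ (gen x) = f x := by
  unfold liftAlg gen
  erw [RingQuot.liftAlgHom_mkAlgHom_apply]
  simp

theorem rel_left (i j : Fin n) :
    ∑ k, gen (i, k, false) * gen (j, k, true) = if i = j then (1 : DualVoiculescu n) else 0 := by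
  have h := RingQuot.mkAlgHom_rel ℂ (Rel.left (n := n) i j)
  simp only [map_sum, map_mul] at h
  refine Eq.trans h ?_
  split_ifs
  · exact map_one _
  · exact map_zero _

theorem rel_right (i j : Fin n) :
    ∑ k, gen (k, i, true) * gen (k, j, false) = if i = j then (1 : DualVoiculescu n) else 0 := by
  have h := RingQuot.mkAlgHom_rel ℂ (Rel.right (n := n) i j)
  simp only [map_sum, map_mul] at h
  refine Eq.trans h ?_
  split_ifs
  · exact map_one _
  · exact map_zero _

/-- Induction on elements of `O⟨n⟩`. -/
theorem induction {P : DualVoiculescu n → Prop} (hc : ∀ c : ℂ, P (algebraMap ℂ _ c))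
    (hg : ∀ x, P (gen x)) (hm : ∀ a b, P a → P b → P (a * b)) (ha : ∀ a b, P a → P b → P (a + b))
    (x : DualVoiculescu n) : P x := by
  obtain ⟨y, rfl⟩ := RingQuot.mkAlgHom_surjective ℂ (Rel n) x
  induction y with
  | grade0 c =>
    have h := hc c
    rwa [show algebraMap ℂ (DualVoiculescu n) c = RingQuot.mkAlgHom ℂ (Rel n)
      (algebraMap ℂ _ c) from ((RingQuot.mkAlgHom ℂ (Rel n)).commutes c).symm] at h
  | grade1 x => exact hg x
  | mul a b h₁ h₂ => rw [map_mul]; exact hm _ _ h₁ h₂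
  | add a b h₁ h₂ => rw [map_add]; exact ha _ _ h₁ h₂

/-- Exchange `u_{ij}` and `u_{ij}^*`. -/
def swap (x : Gen n) : Gen n := (x.1, x.2.1, !x.2.2)

/-- The opposite ring with complex scalars acting through conjugation (auxiliary: conjugate linear
antihomomorphisms into a ring are algebra homomorphisms into this one). -/
def ConjOp (B : Type*) : Type _ := Bᵐᵒᵖ

instance {B : Type*} [Ring B] : Ring (ConjOp B) := inferInstanceAs (Ring Bᵐᵒᵖ)

instance {B : Type*} [Ring B] [Algebra ℂ B] : Algebra ℂ (ConjOp B) :=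
  ((algebraMap ℂ Bᵐᵒᵖ).comp (starRingEnd ℂ)).toAlgebra'
    fun c x => Algebra.commutes (A := Bᵐᵒᵖ) (starRingEnd ℂ c) x

/-- The conjugate linear antihomomorphism exchanging `u_{ij}` and `u_{ij}^*`. -/
def starHom : DualVoiculescu n →ₐ[ℂ] ConjOp (DualVoiculescu n) :=
  liftAlg (fun x => (MulOpposite.op (gen (swap x)) : (DualVoiculescu n)ᵐᵒᵖ))
    (fun i j => by
      apply MulOpposite.unop_injective
      have h := rel_left j i
      refine (map_sum (MulOpposite.opAddEquiv (α := DualVoiculescu n)).symm _ _).trans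
        (h.trans ?_)
      by_cases hij : i = j
      · simp only [hij, if_true]; rfl
      · simp only [hij, Ne.symm hij, if_false]; rfl)
    (fun i j => by
      apply MulOpposite.unop_injective
      have h := rel_right j i
      refine (map_sum (MulOpposite.opAddEquiv (α := DualVoiculescu n)).symm _ _).trans
        (h.trans ?_)
      by_cases hij : i = j
      · simp only [hij, if_true]; rfl
      · simp only [hij, Ne.symm hij, if_false]; rfl)

instance : Star (DualVoiculescu n) where
  star x := MulOpposite.unop (starHom x : (DualVoiculescu n)ᵐᵒᵖ)

theorem star_gen (x : Gen n) : star (gen x) = gen (swap x) :=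
  congrArg MulOpposite.unop (liftAlg_gen (B := ConjOp (DualVoiculescu n)) _ _ _ x)

theorem star_alg (c : ℂ) :
    star (algebraMap ℂ (DualVoiculescu n) c) = algebraMap ℂ _ (starRingEnd ℂ c) :=
  congrArg MulOpposite.unop (starHom.commutes c)

theorem star_add' (a b : DualVoiculescu n) : star (a + b) = star a + star b :=
  congrArg MulOpposite.unop (map_add starHom a b)

theorem star_mul' (a b : DualVoiculescu n) : star (a * b) = star b * star a :=
  congrArg MulOpposite.unop (map_mul starHom a b)

/-- The involution of `O⟨n⟩`: conjugate linear, antimultiplicative, `u_{ij} ↦ u_{ij}^*`. -/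
instance : StarRing (DualVoiculescu n) where
  star_involutive x := by
    refine induction (P := fun x => star (star x) = x) ?_ ?_ ?_ ?_ x
    · intro c; simp [star_alg]
    · intro x; simp [star_gen, swap]
    · intro a b ha hb; rw [star_mul', star_mul', ha, hb]
    · intro a b ha hb; rw [star_add', star_add', ha, hb]
  star_mul := star_mul'
  star_add := star_add'

instance : StarModule ℂ (DualVoiculescu n) where
  star_smul c x := by
    rw [Algebra.smul_def, star_mul, star_alg, Algebra.smul_def]
    exact (Algebra.commutes _ _).symm

/-- The algebra homomorphism underlying `eval`. -/
def evalAlg {B : Type*} [Ring B] [StarRing B] [Algebra ℂ B]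
    (M : unitary (Matrix (Fin n) (Fin n) B)) : DualVoiculescu n →ₐ[ℂ] B :=
  liftAlg (fun x => if x.2.2 then star (M.1 x.1 x.2.1) else M.1 x.1 x.2.1)
    (fun i j => by
      have h₀ : M.1 * star M.1 = 1 := Unitary.mul_star_self_of_mem M.2
      have h : (M.1 * star M.1) i j = (1 : Matrix (Fin n) (Fin n) B) i j := by rw [h₀]
      simpa [Matrix.mul_apply, Matrix.one_apply, Matrix.star_apply] using h)
    (fun i j => by
      have h₀ : star M.1 * M.1 = 1 := Unitary.star_mul_self_of_mem M.2
      have h : (star M.1 * M.1) i j = (1 : Matrix (Fin n) (Fin n) B) i j := by rw [h₀]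
      simpa [Matrix.mul_apply, Matrix.one_apply, Matrix.star_apply] using h)

theorem evalAlg_gen {B : Type*} [Ring B] [StarRing B] [Algebra ℂ B]
    (M : unitary (Matrix (Fin n) (Fin n) B)) (x : Gen n) :
    evalAlg M (gen x) = if x.2.2 then star (M.1 x.1 x.2.1) else M.1 x.1 x.2.1 :=
  liftAlg_gen _ _ _ _

/-- The morphism of involutive algebras `O⟨n⟩ → B`, `u_{ij} ↦ M_{ij}`, induced by a unitary matrix
`M` with entries in `B`. -/
def eval {B : Type*} [Ring B] [StarRing B] [Algebra ℂ B] [StarModule ℂ B]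
    (M : unitary (Matrix (Fin n) (Fin n) B)) : DualVoiculescu n →⋆ₐ[ℂ] B where
  toAlgHom := evalAlg M
  map_star' x := by
    refine induction (P := fun x => evalAlg M (star x) = star (evalAlg M x)) ?_ ?_ ?_ ?_ x
    · intro c
      rw [star_alg, AlgHom.commutes, AlgHom.commutes]
      exact algebraMap_star_comm c
    · rintro ⟨i, j, b⟩
      rw [star_gen, evalAlg_gen, evalAlg_gen]
      cases b <;> simp [swap]
    · intro a b ha hb; rw [star_mul, map_mul, ha, hb, map_mul, star_mul]
    · intro a b ha hb; rw [star_add, map_add, ha, hb, map_add, star_add]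

theorem eval_u {B : Type*} [Ring B] [StarRing B] [Algebra ℂ B] [StarModule ℂ B]
    (M : unitary (Matrix (Fin n) (Fin n) B)) (i j : Fin n) : eval M (u i j) = M.1 i j :=
  (evalAlg_gen M (i, j, false)).trans (by simp)

end DualVoiculescu

/-! ### Free probability -/

namespace FreeProb

variable {A : Type*} [CStarAlgebra A]

/-- `τ` is a tracial state. -/
structure IsTracialState (τ : A →ₗ[ℂ] ℂ) : Prop where
  map_one : τ 1 = 1
  nonneg : ∀ a, 0 ≤ τ (star a * a)
  tracial : ∀ a b, τ (a * b) = τ (b * a)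

/-- `τ` is faithful. -/
def IsFaithful (τ : A →ₗ[ℂ] ℂ) : Prop := ∀ a, τ (star a * a) = 0 → a = 0

/-- Freeness of a family of involutive unital subalgebras: `τ` vanishes on every nonempty word
`a₁ a₂ ⋯ a_m` of centred elements in which neighbouring letters come from different members of
the family. -/
def IsFree (τ : A →ₗ[ℂ] ℂ) {ι : Type*} (S : ι → StarSubalgebra ℂ A) : Prop :=
  ∀ l : List (ι × A), l ≠ [] → (∀ p ∈ l, p.2 ∈ S p.1 ∧ τ p.2 = 0) →
    l.IsChain (fun p q => p.1 ≠ q.1) → τ (l.map Prod.snd).prod = 0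

/-- Freeness of two involutive unital subalgebras. -/
def IsFreePair (τ : A →ₗ[ℂ] ℂ) (B C : StarSubalgebra ℂ A) : Prop :=
  IsFree τ (fun b : Bool => if b then B else C)

/-- The involutive unital subalgebra generated by the entries of a matrix. -/
def entryAlg {n : ℕ} (M : Matrix (Fin n) (Fin n) A) : StarSubalgebra ℂ A :=
  StarAlgebra.adjoin ℂ {a | ∃ i j, a = M i j}

/-- Joint moments of a centred semicircular family `(x_i)` with covariance `C i j = τ(x_i x_j)`,
that is `∑_π ∏_{\{p, q\} ∈ π, p < q} C (i_p) (i_q)` over all non-crossing pairings `π` of the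
letters of the word. The sum is organised according to the partner `i_k` of the first letter, which
separates the word between them from the word after `i_k`. (Equivalently: all free cumulants of
order different from `2` vanish and `C` gives those of order `2`.) -/
def semicircularMoment {ι : Type*} (C : ι → ι → ℂ) : List ι → ℂ
  | [] => 1
  | i :: l => ∑ k : Fin l.length,
      C i l[k] * semicircularMoment C (l.take k) * semicircularMoment C (l.drop (k + 1))
  termination_by l => l.length
  decreasing_by
    · simp
    · simp

/-- `W` is an `n × n` matrix of free Brownian noise with respect to the filtration `F`: it starts at
`0`, is selfadjoint and adapted, and for `s ≤ t` the entries of `W t - W s` are jointly free from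
`F s` and form a centred semicircular family with covariance
`τ (ΔW_{ij} ΔW_{kl}) = (t - s) δ_{il} δ_{jk}`. -/
structure IsMatrixFreeBM {n : ℕ} (τ : A →ₗ[ℂ] ℂ) (F : ℝ → StarSubalgebra ℂ A)
    (W : ℝ → Matrix (Fin n) (Fin n) A) : Prop where
  zero : W 0 = 0
  selfAdjoint : ∀ t, 0 ≤ t → (W t).IsHermitian
  adapted : ∀ t, 0 ≤ t → ∀ i j, W t i j ∈ F t
  free : ∀ s t, 0 ≤ s → s ≤ t → IsFreePair τ (F s) (entryAlg (W t - W s))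
  semicircular : ∀ s t, 0 ≤ s → s ≤ t → ∀ l : List (Fin n × Fin n),
    τ (l.map fun p => (W t - W s) p.1 p.2).prod =
      semicircularMoment
        (fun p q => if p.1 = q.2 ∧ p.2 = q.1 then ((t - s : ℝ) : ℂ) else 0) l

/-- The left Itô integral of a continuous process: `I = ∫₀ᵗ dW_s X_s` (matrix product), the limit,
entrywise in `L²(A, τ)`, of the Riemann sums `∑ₖ (W_{p_{k+1}} - W_{p_k}) X_{p_k}` along partitions
`0 = p_0 ≤ ⋯ ≤ p_N = t` whose mesh tends to `0`. -/
def IsItoIntegral {n : ℕ} (τ : A →ₗ[ℂ] ℂ) (W X : ℝ → Matrix (Fin n) (Fin n) A) (t : ℝ)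
    (I : Matrix (Fin n) (Fin n) A) : Prop :=
  ∀ ε > 0, ∃ δ > 0, ∀ (N : ℕ) (p : ℕ → ℝ), p 0 = 0 → p N = t →
    (∀ k < N, p k ≤ p (k + 1) ∧ p (k + 1) - p k < δ) →
    ∀ i j, let D := (I - ∑ k ∈ Finset.range N, (W (p (k + 1)) - W (p k)) * X (p k)) i j
      (τ (star D * D)).re < ε

/-- `U` solves `dU = (i / √n) dW U - (1/2) U dt`, `U 0 = 1`, driven by the free Brownian noise `W`
(as a norm continuous adapted process): the free unitary Brownian motion of dimension `n`. -/
structure IsFreeUnitaryBM {n : ℕ} (τ : A →ₗ[ℂ] ℂ) (F : ℝ → StarSubalgebra ℂ A)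
    (W U : ℝ → Matrix (Fin n) (Fin n) A) : Prop where
  filtration : ∀ s t, 0 ≤ s → s ≤ t → F s ≤ F t
  noise : IsMatrixFreeBM τ F W
  adapted : ∀ t, 0 ≤ t → ∀ i j, U t i j ∈ F t
  continuous : ∀ i j, ContinuousOn (fun t => U t i j) (Set.Ici 0)
  zero : U 0 = 1
  sde : ∀ t, 0 ≤ t → ∃ I, IsItoIntegral τ W U t I ∧
    U t = 1 + (Complex.I / (Real.sqrt n : ℂ)) • I
      - (1 / 2 : ℂ) • Matrix.of (fun i j => ∫ s in (0 : ℝ)..t, U s i j)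

end FreeProb

end

/-! Work in `Matrix (Fin n) (Fin n) A` with the trace φ = (1/n) Tr ⊗ τ (`normTrace`). The heart of
the matter is that the algebra generated by U(t) and its adjoint is free from the scalar matrices
(`IsFreeUnitaryBM.freeFamily_scalars`). As the entries of V are free from those of U(t),
`freeFamily_matrix` upgrades this to freeness from all matrices over the entry algebra of V, an
algebra containing both V and the scalar matrices. Now compare a polynomial in U(t) and scalar
matrices with the same polynomial in V U(t) V⁻¹. Conjugating an alternating centred word in letters
V c V⁻¹ and d by V⁻¹ gives a word in the letters c and V⁻¹ d V, which is again alternating and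
centred, so both words have trace zero (`map_eq_of_mem_conjPairs`). Matrix units are scalar
matrices, so the value at any u, placed in one matrix entry, is such a polynomial
(`single_eval_mem_conjPairs`), and φ of it is τ/n.

Freeness from the scalars is inherited from the noise. The covariance δ_il δ_jk makes each
contraction in the Schwinger-Dyson equation split a trace into two traces of smaller degree;
induction on the degree then shows that an increment is free from the scalar matrices
(`normTrace_altWord_pow`). Increments are added one at a time by associativity of freeness
(`freeFamily_sup`). Finally U(t) is the L² limit of Euler schemes, which are polynomials in the
noise (`IsFreeUnitaryBM.tendsto_euler`, from the Itô isometry and Gronwall), and freeness survives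
L² closure because φ is tracial and multiplications are L² bounded.

For unitarity, one Euler step of size h multiplies x*x by 1 + h²/4 and adds a fluctuation x*(w²/n -
h)x, centred given the past, with squared L² norm h²‖x‖₂⁴. Fluctuations are orthogonal, so over N =
T/h steps their squares add up to O(T²/N). In the limit φ(y(U*U - 1)) = 0 for every y, and
faithfulness gives U*U = 1. -/

namespace FreeProb

/-! ### Alternating words and freeness of subalgebras -/

section Words

variable {ι κ M N : Type*}

/-- `AltWord X i j x`: the element `x` is a product `x₁ x₂ ⋯ x_m` with `m ≥ 1` and
`x_k ∈ X i_k`, where neighbouring indices differ, `i = i_1` and `j = i_m`. -/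
inductive AltWord [Mul M] (X : ι → Set M) : ι → ι → M → Prop
  | single {i : ι} {x : M} (hx : x ∈ X i) : AltWord X i i x
  | cons {i j k : ι} {x y : M} (hx : x ∈ X i) (hij : i ≠ j) (hy : AltWord X j k y) :
      AltWord X i k (x * y)

namespace AltWord

theorem append [Semigroup M] {X : ι → Set M} {i j k l : ι} {x y : M} (hx : AltWord X i j x)
    (hjk : j ≠ k) (hy : AltWord X k l y) : AltWord X i l (x * y) := by
  induction hx with
  | single hx => exact .cons hx hjk hy
  | cons hx hij _ ih => rw [mul_assoc]; exact .cons hx hij (ih hjk)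

theorem map [Mul M] [Mul N] {X : ι → Set M} {Y : κ → Set N} (f : ι → κ)
    (hf : Function.Injective f) (g : M → N) (hg : ∀ x y, g (x * y) = g x * g y)
    (h : ∀ i, ∀ x ∈ X i, g x ∈ Y (f i)) {i j : ι} {x : M} (hx : AltWord X i j x) :
    AltWord Y (f i) (f j) (g x) := by
  induction hx with
  | single hx => exact .single (h _ _ hx)
  | cons hx hij _ ih => rw [hg]; exact .cons (h _ _ hx) (hf.ne hij) ih

theorem mono [Mul M] {X Y : ι → Set M} (h : ∀ i, X i ⊆ Y i) {i j : ι} {x : M}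
    (hx : AltWord X i j x) : AltWord Y i j x :=
  hx.map id Function.injective_id id (fun _ _ => rfl) fun i _ hx => h i hx

theorem mem [Mul M] {S : Type*} [SetLike S M] [MulMemClass S M] (s : S) {X : ι → Set M}
    (h : ∀ i, ∀ x ∈ X i, x ∈ s) {i j : ι} {x : M} (hx : AltWord X i j x) : x ∈ s := by
  induction hx with
  | single hx => exact h _ _ hx
  | cons hx _ _ ih => exact mul_mem (h _ _ hx) ih

/-- An alternating word whose letters are linear combinations of elements of `Y` is a linear
combination of alternating words in `Y`. -/
theorem mem_span [Ring M] [Algebra ℂ M] {X Y : ι → Set M}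
    (h : ∀ i, ∀ x ∈ X i, x ∈ Submodule.span ℂ (Y i)) {i j : ι} {x : M} (hx : AltWord X i j x) :
    x ∈ Submodule.span ℂ {y | AltWord Y i j y} := by
  induction hx with
  | single hx => exact Submodule.span_mono (fun y hy => AltWord.single hy) (h _ _ hx)
  | @cons i j k x y hx hij _ ih =>
    have := Submodule.mul_mem_mul (h _ _ hx) ih
    rw [Submodule.span_mul_span] at this
    refine Submodule.span_mono ?_ this
    rintro _ ⟨a, ha, b, hb, rfl⟩
    exact .cons ha hij hb

end AltWord

variable [Ring M] [Algebra ℂ M]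

/-- The centred elements of a subalgebra. -/
def centred (φ : M →ₗ[ℂ] ℂ) (S : Subalgebra ℂ M) : Set M := {x | x ∈ S ∧ φ x = 0}

/-- Freeness of a family of subalgebras with respect to a linear functional. -/
def FreeFamily (φ : M →ₗ[ℂ] ℂ) (S : ι → Subalgebra ℂ M) : Prop :=
  ∀ i j x, AltWord (fun i => centred φ (S i)) i j x → φ x = 0

/-- The family of two subalgebras. -/
def pair (C D : Subalgebra ℂ M) (b : Bool) : Subalgebra ℂ M := cond b C D

theorem map_eq_zero_of_mem_span {φ : M →ₗ[ℂ] ℂ} {s : Set M} (h : ∀ x ∈ s, φ x = 0) {x : M}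
    (hx : x ∈ Submodule.span ℂ s) : φ x = 0 :=
  (Submodule.span_le (p := LinearMap.ker φ)).2 h hx

/-- Freeness may be tested on sets that span the centred parts. -/
theorem FreeFamily.of_span {φ : M →ₗ[ℂ] ℂ} {S : ι → Subalgebra ℂ M} (Y : ι → Set M)
    (hY : ∀ i, centred φ (S i) ⊆ Submodule.span ℂ (Y i))
    (h : ∀ i j x, AltWord Y i j x → φ x = 0) : FreeFamily φ S := fun i j _ hx =>
  map_eq_zero_of_mem_span (fun y (hy : AltWord Y i j y) => h i j y hy)
    (hx.mem_span fun i _ hx => hY i hx)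

theorem FreeFamily.mono {φ : M →ₗ[ℂ] ℂ} {S T : ι → Subalgebra ℂ M} (hS : FreeFamily φ S)
    (h : ∀ i, T i ≤ S i) : FreeFamily φ T := fun i j x hx =>
  hS i j x (hx.mono (Y := fun i => centred φ (S i)) fun i _ hx => ⟨h i hx.1, hx.2⟩)

theorem sub_algebraMap_mem_centred {φ : M →ₗ[ℂ] ℂ} (h1 : φ 1 = 1) {S : Subalgebra ℂ M} {x : M}
    (hx : x ∈ S) : x - algebraMap ℂ M (φ x) ∈ centred φ S :=
  ⟨sub_mem hx (S.algebraMap_mem _), by simp [Algebra.algebraMap_eq_smul_one, h1]⟩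

/-- The algebra generated by a family of subalgebras is spanned by `1` and the alternating words
of centred elements. -/
theorem iSup_le_span_altWord {φ : M →ₗ[ℂ] ℂ} (h1 : φ 1 = 1) (S : ι → Subalgebra ℂ M) {x : M}
    (hx : x ∈ ⨆ i, S i) :
    x ∈ Submodule.span ℂ ({1} ∪ {y | ∃ i j, AltWord (fun i => centred φ (S i)) i j y}) := by
  set P := Submodule.span ℂ ({1} ∪ {y | ∃ i j, AltWord (fun i => centred φ (S i)) i j y})
  have hone : (1 : M) ∈ P := Submodule.subset_span (Or.inl rfl)
  have hword : ∀ {i j y}, AltWord (fun i => centred φ (S i)) i j y → y ∈ P :=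
    fun h => Submodule.subset_span (Or.inr ⟨_, _, h⟩)
  have hmem : ∀ i, ∀ c ∈ S i, c ∈ P := fun i c hc => by
    have := add_mem (hword (.single (sub_algebraMap_mem_centred h1 hc)))
      (P.smul_mem (φ c) hone)
    rwa [← Algebra.algebraMap_eq_smul_one, sub_add_cancel] at this
  -- A factor from the algebra of the first letter merges with that letter, any other factor becomes
  -- a new first letter. Recentring leaves a scalar multiple of a word already in the span.
  have hmul : ∀ i, ∀ c ∈ S i, ∀ y ∈ P, c * y ∈ P := by
    intro i c hc y hy
    have hle : P ≤ P.comap (LinearMap.mulLeft ℂ c) := by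
      refine Submodule.span_le.2 ?_
      rintro y (rfl | ⟨j, k, hy⟩)
      · simpa using hmem i c hc
      · change c * y ∈ P
        have split : ∀ d ∈ S i, ∀ z ∈ P, (d - algebraMap ℂ M (φ d)) * z ∈ P → d * z ∈ P :=
          fun d _ z hz h => by
            have := add_mem h (P.smul_mem (φ d) hz)
            rwa [sub_mul, ← Algebra.smul_def, sub_add_cancel] at this
        by_cases hij : i = j
        · subst hij
          cases hy with
          | single hx => exact hmem i _ (mul_mem hc hx.1)
          | cons hx hij hz =>
            rw [← mul_assoc]
            exact split _ (mul_mem hc hx.1) _ (hword hz)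
              (hword (.cons (sub_algebraMap_mem_centred h1 (mul_mem hc hx.1)) hij hz))
        · exact split c hc y (hword hy)
            (hword (.cons (sub_algebraMap_mem_centred h1 hc) hij hy))
    exact hle hy
  have hx' : x ∈ Algebra.adjoin ℂ (⋃ i, (S i : Set M)) := by
    refine (iSup_le fun i => ?_ : ⨆ i, S i ≤ _) hx
    exact fun y hy => Algebra.subset_adjoin (Set.mem_iUnion.2 ⟨i, hy⟩)
  rw [← Subalgebra.mem_toSubmodule, Algebra.adjoin_eq_span] at hx'
  refine (Submodule.span_le.2 fun y hy => ?_) hx'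
  induction hy using Submonoid.closure_induction_left with
  | one => exact hone
  | mul_left c hc y _ ih =>
    obtain ⟨i, hi⟩ := Set.mem_iUnion.1 hc
    exact hmul i c hi y ih

/-- If `C₁` is free from a subalgebra containing `C₂` and `D`, and `C₂` is free from `D`, then the
algebra generated by `C₁` and `C₂` is free from `D`. -/
theorem freeFamily_sup {φ : M →ₗ[ℂ] ℂ} (h1 : φ 1 = 1) {C₁ C₂ D N : Subalgebra ℂ M}
    (hN : FreeFamily φ (pair C₁ N)) (hC₂ : C₂ ≤ N) (hD : D ≤ N)
    (hCD : FreeFamily φ (pair C₂ D)) : FreeFamily φ (pair (C₁ ⊔ C₂) D) := by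
  -- Three kinds of letters: `none` for `C₁`, `some true` for `C₂`, `some false` for `D`.
  set Z : Option Bool → Set M := fun o => centred φ (o.elim C₁ (pair C₂ D)) with hZ
  -- A maximal run of letters from `C₂` and `D` is one centred element of `N`, because `C₂` and `D`
  -- are free. A word in three kinds of letters thus becomes a word alternating between `C₁` and
  -- `N`; `z` is the run read so far.
  have key : ∀ o o' y, AltWord Z o o' y →
      (o = none → ∃ k, AltWord (fun b => centred φ (pair C₁ N b)) true k y) ∧
      ∀ b, o = some b → ∀ z, (z = 1 ∨ ∃ i j, AltWord (fun b => centred φ (pair C₂ D b)) i j z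
        ∧ j ≠ b) → ∃ k, AltWord (fun b => centred φ (pair C₁ N b)) false k (z * y) := by
    have hfull : ∀ i j z, AltWord (fun b => centred φ (pair C₂ D b)) i j z →
        z ∈ centred φ (pair C₁ N false) := fun i j z hz =>
      ⟨hz.mem N fun b x hx => by cases b; exacts [hD hx.1, hC₂ hx.1], hCD _ _ _ hz⟩
    have hext : ∀ b x, x ∈ Z (some b) → ∀ z, (z = 1 ∨ ∃ i j,
        AltWord (fun b => centred φ (pair C₂ D b)) i j z ∧ j ≠ b) →
        ∃ i, AltWord (fun b => centred φ (pair C₂ D b)) i b (z * x) := by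
      rintro b x hx z (rfl | ⟨i, j, hz, hj⟩)
      · exact ⟨b, by rw [one_mul]; exact .single hx⟩
      · exact ⟨i, hz.append hj (.single hx)⟩
    intro o o' y hy
    induction hy with
    | @single o x hx =>
      refine ⟨?_, ?_⟩
      · rintro rfl; exact ⟨_, .single hx⟩
      · rintro b rfl z hz
        obtain ⟨i, hi⟩ := hext b x hx z hz
        exact ⟨_, .single (hfull _ _ _ hi)⟩
    | @cons o o₁ o₂ x y hx hne hy ih =>
      refine ⟨?_, ?_⟩
      · rintro rfl
        obtain ⟨b, rfl⟩ := Option.ne_none_iff_exists'.1 hne.symm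
        obtain ⟨k, hk⟩ := ih.2 b rfl 1 (Or.inl rfl)
        rw [one_mul] at hk
        exact ⟨k, .cons hx (by simp) hk⟩
      · rintro b rfl z hz
        obtain ⟨i, hi⟩ := hext b x hx z hz
        rw [← mul_assoc]
        cases o₁ with
        | none =>
          obtain ⟨k, hk⟩ := ih.1 rfl
          exact ⟨k, .cons (hfull _ _ _ hi) (by simp) hk⟩
        | some b' => exact ih.2 b' rfl _ (Or.inr ⟨i, b, hi, fun h => hne (h ▸ rfl)⟩)
  have hthree : ∀ o o' y, AltWord Z o o' y → φ y = 0 := by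
    intro o o' y hy
    cases o with
    | none => obtain ⟨k, hk⟩ := (key _ _ _ hy).1 rfl; exact hN _ _ _ hk
    | some b =>
      obtain ⟨k, hk⟩ := (key _ _ _ hy).2 b rfl 1 (Or.inl rfl)
      rw [one_mul] at hk
      exact hN _ _ _ hk
  set e : Bool → Option Bool := fun b => if b then none else some true
  have he : Function.Injective e := by intro a b; cases a <;> cases b <;> simp [e]
  have hsub : ∀ i j y, AltWord (fun b => centred φ (pair C₁ C₂ b)) i j y →
      AltWord Z (e i) (e j) y := fun i j y hy =>
    hy.map e he id (fun _ _ => rfl) fun b x hx => by cases b <;> exact hx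
  refine FreeFamily.of_span (fun b => cond b
    {y | ∃ i j, AltWord (fun b => centred φ (pair C₁ C₂ b)) i j y} (centred φ D)) ?_ ?_
  · rintro (_ | _) x hx
    · exact Submodule.subset_span hx
    · have hx' : x ∈ ⨆ b, pair C₁ C₂ b := by
        rw [iSup_bool_eq]; exact hx.1
      have := iSup_le_span_altWord h1 _ hx'
      rw [Submodule.span_union, Submodule.mem_sup] at this
      obtain ⟨a, ha, y, hy, rfl⟩ := this
      obtain ⟨c, rfl⟩ := Submodule.mem_span_singleton.1 ha
      have h0 : φ y = 0 := map_eq_zero_of_mem_span (by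
        rintro y ⟨i, j, hy⟩; exact hthree _ _ _ (hsub _ _ _ hy)) hy
      -- The words have expectation zero, so a centred element has no component along `1`.
      have hc : c = 0 := by simpa [h0, h1] using hx.2
      simpa [hc] using hy
  · intro i j x hx
    -- Flatten the words in `C₁` and `C₂` that serve as letters. The equivalence records whether the
    -- flattened word starts in `D`, which keeps it alternating at each junction.
    obtain ⟨o, o', -, h⟩ : ∃ o o', (i = false ↔ o = some false) ∧ AltWord Z o o' x := by
      induction hx with
      | @single i x hx =>
        cases i with
        | false => exact ⟨some false, some false, by simp, .single hx⟩
        | true =>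
          obtain ⟨p, q, h⟩ := hx
          exact ⟨_, _, by cases p <;> simp [e], hsub _ _ _ h⟩
      | @cons i j k x y hx hij hy ih =>
        obtain ⟨o, o', ho, hw⟩ := ih
        cases i with
        | false =>
          refine ⟨some false, o', by simp, .cons hx (fun h => hij ?_) hw⟩
          exact (ho.2 h.symm).symm
        | true =>
          obtain rfl : j = false := by cases j <;> simp_all
          obtain ⟨p, q, h⟩ := hx
          have h' := hsub _ _ _ h
          refine ⟨_, o', by cases p <;> simp [e], h'.append ?_ hw⟩
          rw [ho.1 rfl]
          cases q <;> simp [e]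
    exact hthree _ _ _ h

end Words

/-! ### Matrices over a noncommutative probability space -/

section Matrices

variable {A : Type*} [Ring A] [Algebra ℂ A] {n : ℕ}

/-- The functional `(1 / n) Tr ⊗ τ`. -/
noncomputable def normTrace (τ : A →ₗ[ℂ] ℂ) : Matrix (Fin n) (Fin n) A →ₗ[ℂ] ℂ :=
  (n : ℂ)⁻¹ • τ ∘ₗ Matrix.traceLinearMap (Fin n) ℂ A

/-- The entrywise expectation. -/
def expect (τ : A →ₗ[ℂ] ℂ) : Matrix (Fin n) (Fin n) A →ₗ[ℂ] Matrix (Fin n) (Fin n) ℂ :=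
  τ.mapMatrix

/-- Scalar matrices as matrices over `A`. -/
def const : Matrix (Fin n) (Fin n) ℂ →ₐ[ℂ] Matrix (Fin n) (Fin n) A :=
  (Algebra.ofId ℂ A).mapMatrix

/-- The subalgebra of matrices with scalar entries. -/
def scalars (A : Type*) [Ring A] [Algebra ℂ A] (n : ℕ) :
    Subalgebra ℂ (Matrix (Fin n) (Fin n) A) :=
  (const (A := A) (n := n)).range

theorem normTrace_apply (τ : A →ₗ[ℂ] ℂ) (x : Matrix (Fin n) (Fin n) A) :
    normTrace τ x = (n : ℂ)⁻¹ * ∑ i, τ (x i i) := by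
  simp [normTrace, Matrix.trace]

theorem expect_apply (τ : A →ₗ[ℂ] ℂ) (x : Matrix (Fin n) (Fin n) A) (i j : Fin n) :
    expect τ x i j = τ (x i j) := rfl

theorem const_apply (m : Matrix (Fin n) (Fin n) ℂ) (i j : Fin n) :
    const (A := A) m i j = algebraMap ℂ A (m i j) := rfl

theorem normTrace_eq_trace_expect (τ : A →ₗ[ℂ] ℂ) (x : Matrix (Fin n) (Fin n) A) :
    normTrace τ x = (n : ℂ)⁻¹ * (expect τ x).trace := by
  simp [normTrace_apply, Matrix.trace, expect_apply]

theorem normTrace_eq_zero_of_expect {τ : A →ₗ[ℂ] ℂ} {x : Matrix (Fin n) (Fin n) A}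
    (h : expect τ x = 0) : normTrace τ x = 0 := by
  simp [normTrace_eq_trace_expect, h]

theorem expect_const_mul (τ : A →ₗ[ℂ] ℂ) (m : Matrix (Fin n) (Fin n) ℂ)
    (x : Matrix (Fin n) (Fin n) A) : expect τ (const m * x) = m * expect τ x := by
  ext i j
  simp [expect_apply, Matrix.mul_apply, const_apply, ← Algebra.smul_def]

theorem expect_mul_const (τ : A →ₗ[ℂ] ℂ) (m : Matrix (Fin n) (Fin n) ℂ)
    (x : Matrix (Fin n) (Fin n) A) : expect τ (x * const m) = expect τ x * m := by
  ext i j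
  simp only [expect_apply, Matrix.mul_apply, const_apply, map_sum]
  refine Finset.sum_congr rfl fun k _ => ?_
  rw [← Algebra.commutes, ← Algebra.smul_def, map_smul, smul_eq_mul, mul_comm]

theorem expect_one {τ : A →ₗ[ℂ] ℂ} (h1 : τ 1 = 1) :
    expect τ (1 : Matrix (Fin n) (Fin n) A) = 1 := by
  ext i j
  by_cases h : i = j <;> simp [expect_apply, Matrix.one_apply, h, h1]

theorem expect_const {τ : A →ₗ[ℂ] ℂ} (h1 : τ 1 = 1) (m : Matrix (Fin n) (Fin n) ℂ) :
    expect τ (const m) = m := by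
  rw [← mul_one (const m), expect_const_mul, expect_one h1, mul_one]

theorem normTrace_one [NeZero n] {τ : A →ₗ[ℂ] ℂ} (h1 : τ 1 = 1) :
    normTrace τ (1 : Matrix (Fin n) (Fin n) A) = 1 := by
  simp [normTrace_apply, h1]

theorem normTrace_mul_comm {τ : A →ₗ[ℂ] ℂ} (h : ∀ a b, τ (a * b) = τ (b * a))
    (x y : Matrix (Fin n) (Fin n) A) : normTrace τ (x * y) = normTrace τ (y * x) := by
  simp only [normTrace_apply, Matrix.mul_apply, map_sum, h (x _ _)]
  rw [Finset.sum_comm]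

theorem scalars_le_matrix (S : Subalgebra ℂ A) : scalars A n ≤ S.matrix := by
  rintro _ ⟨m, rfl⟩ i j
  exact S.algebraMap_mem _

/-- The entrywise expectation vanishes as soon as all traces against scalar matrices do. -/
theorem expect_eq_zero [NeZero n] {τ : A →ₗ[ℂ] ℂ} {x : Matrix (Fin n) (Fin n) A}
    (h : ∀ m, normTrace τ (x * const m) = 0) : expect τ x = 0 := by
  ext i j
  have := h (Matrix.single j i 1)
  rw [normTrace_eq_trace_expect, expect_mul_const, Matrix.trace_mul_single] at this
  simpa [NeZero.ne n] using this

/-- The matrices with centred entries in `S`. -/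
def entryCentred (τ : A →ₗ[ℂ] ℂ) (S : Subalgebra ℂ A) : Set (Matrix (Fin n) (Fin n) A) :=
  {x | x ∈ S.matrix ∧ expect τ x = 0}

theorem sub_const_mem_entryCentred {τ : A →ₗ[ℂ] ℂ} (h1 : τ 1 = 1) {S : Subalgebra ℂ A}
    {x : Matrix (Fin n) (Fin n) A} (hx : x ∈ S.matrix) :
    x - const (expect τ x) ∈ entryCentred τ S :=
  ⟨sub_mem hx (scalars_le_matrix S ⟨_, rfl⟩), by rw [map_sub, expect_const h1, sub_self]⟩

/-- Alternating products of matrices with centred entries from free algebras have centred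
entries. -/
theorem expect_altWord {ι : Type*} {τ : A →ₗ[ℂ] ℂ} {S : ι → Subalgebra ℂ A}
    (hS : FreeFamily τ S) {i j : ι} {x : Matrix (Fin n) (Fin n) A}
    (hx : AltWord (fun i => entryCentred τ (S i)) i j x) : expect τ x = 0 := by
  have key : ∀ a b, x a b ∈ Submodule.span ℂ {y | AltWord (fun i => centred τ (S i)) i j y} := by
    induction hx with
    | single hx => exact fun a b =>
        Submodule.subset_span (.single ⟨hx.1 a b, congrFun (congrFun hx.2 a) b⟩)
    | @cons i j k x y hx hij _ ih =>
      intro a b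
      rw [Matrix.mul_apply]
      refine Submodule.sum_mem _ fun c _ => ?_
      have := Submodule.mul_mem_mul (Submodule.subset_span (R := ℂ)
        (show x a c ∈ centred τ (S i) from ⟨hx.1 a c, congrFun (congrFun hx.2 a) c⟩)) (ih c b)
      rw [Submodule.span_mul_span] at this
      refine Submodule.span_mono ?_ this
      rintro _ ⟨u, hu, v, hv, rfl⟩
      exact .cons hu hij hv
  ext a b
  exact map_eq_zero_of_mem_span (fun y hy => hS _ _ y hy) (key a b)

/-- If an algebra `C` of matrices is free from the scalar matrices and its entries are free from
`S₂`, then `C` is free from the matrices over `S₂`. -/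
theorem freeFamily_matrix [NeZero n] {τ : A →ₗ[ℂ] ℂ} (h1 : τ 1 = 1) {S₁ S₂ : Subalgebra ℂ A}
    (hS : FreeFamily τ (pair S₁ S₂)) {C : Subalgebra ℂ (Matrix (Fin n) (Fin n) A)}
    (hC : C ≤ S₁.matrix) (hCD : FreeFamily (normTrace τ) (pair C (scalars A n))) :
    FreeFamily (normTrace τ) (pair C S₂.matrix) := by
  set φ : Matrix (Fin n) (Fin n) A →ₗ[ℂ] ℂ := normTrace τ with hφ
  set X := fun b => centred φ (pair C (scalars A n) b) with hX
  set R : Bool → Set (Matrix (Fin n) (Fin n) A) := fun b => entryCentred τ (pair S₁ S₂ b) with hR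
  have h1' : φ 1 = 1 := normTrace_one h1
  have hXmem : ∀ i j z, AltWord X i j z → z ∈ S₁.matrix := fun i j z hz =>
    hz.mem _ fun b x hx => by cases b; exacts [scalars_le_matrix _ hx.1, hC hx.1]
  -- A run alternating between `C` and the scalars and ending in `C` has trace zero against every
  -- scalar matrix, by freeness. All its entries are therefore centred.
  have hrun_mul : ∀ i z, AltWord X i true z → ∀ m, z * const m ∈ R true := by
    intro i z hz m
    have hz0 : φ z = 0 := hCD _ _ _ hz
    refine ⟨mul_mem (hXmem _ _ _ hz) (scalars_le_matrix _ ⟨m, rfl⟩), ?_⟩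
    rw [expect_mul_const, expect_eq_zero, zero_mul]
    intro m'
    have := hCD _ _ _ (hz.append (by simp) (.single (i := false)
      (sub_algebraMap_mem_centred h1' (S := scalars A n) ⟨m', rfl⟩)))
    rw [mul_sub, map_sub, sub_eq_zero] at this
    refine this.trans ?_
    rw [← Algebra.commutes, ← Algebra.smul_def, map_smul, hz0, smul_zero]
  have hrun : ∀ i z, AltWord X i true z → z ∈ R true := fun i z hz => by
    simpa using hrun_mul i z hz 1
  set good := Submodule.span ℂ {y | ∃ k, AltWord R true k y} with hgood
  have hconst : ∀ b ∈ centred φ S₂.matrix, const (expect τ b) ∈ X false := fun b hb =>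
    ⟨⟨_, rfl⟩, by
      have := hb.2
      rw [hφ, normTrace_eq_trace_expect] at this ⊢
      rwa [expect_const h1]⟩
  have hsplit : ∀ b ∈ centred φ S₂.matrix,
      b = (b - const (expect τ b)) + const (expect τ b) := fun b _ => by simp
  -- Split each letter over `S₂` into its entrywise centred part, which ends the current run `z`,
  -- and its scalar expectation, which is centred for `φ` and prolongs the run. What results are
  -- alternating products of entrywise centred matrices.
  have key : ∀ i j y, AltWord (fun b => centred φ (pair C S₂.matrix b)) i j y →
      (i = true → ∀ z, (z = 1 ∨ ∃ i, AltWord X i false z) → z * y ∈ good) ∧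
      (i = false → ∀ k z, AltWord X k true z → z * y ∈ good) := by
    intro i j y hy
    have hext : ∀ z, (z = 1 ∨ ∃ i, AltWord X i false z) → ∀ c ∈ X true,
        ∃ i, AltWord X i true (z * c) := by
      rintro z (rfl | ⟨i, hz⟩) c hc
      · exact ⟨true, by rw [one_mul]; exact .single hc⟩
      · exact ⟨i, hz.append (by simp) (.single hc)⟩
    induction hy with
    | @single i x hx =>
      refine ⟨?_, ?_⟩
      · rintro rfl z hz
        obtain ⟨k, hk⟩ := hext z hz x hx
        exact Submodule.subset_span ⟨_, .single (hrun _ _ hk)⟩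
      · rintro rfl k z hz
        rw [hsplit x hx, mul_add]
        refine add_mem (Submodule.subset_span ⟨_, .cons (hrun _ _ hz) (j := false) (by simp)
          (.single (sub_const_mem_entryCentred h1 hx.1))⟩)
          (Submodule.subset_span ⟨_, .single (hrun_mul _ _ hz _)⟩)
    | @cons i j k x y hx hij hy ih =>
      refine ⟨?_, ?_⟩
      · rintro rfl z hz
        obtain rfl : j = false := Bool.eq_false_iff.2 hij.symm
        obtain ⟨k, hk⟩ := hext z hz x hx
        rw [← mul_assoc]
        exact ih.2 rfl _ _ hk
      · rintro rfl l z hz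
        obtain rfl : j = true := Bool.ne_false_iff.1 hij.symm
        rw [← mul_assoc, hsplit x hx, mul_add, add_mul]
        refine add_mem ?_ (ih.1 rfl _ (Or.inr ⟨l, hz.append (by simp) (.single (hconst x hx))⟩))
        have hy' := ih.1 rfl 1 (Or.inl rfl)
        rw [one_mul] at hy'
        have hle : good ≤ good.comap (LinearMap.mulLeft ℂ (z * (x - const (expect τ x)))) := by
          refine Submodule.span_le.2 ?_
          rintro y ⟨k, hk⟩
          refine Submodule.subset_span ⟨k, ?_⟩
          change AltWord R true k (z * (x - const (expect τ x)) * y)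
          rw [mul_assoc]
          exact .cons (hrun _ _ hz) (j := false) (by simp)
            (.cons (sub_const_mem_entryCentred h1 hx.1) (by simp) hk)
        exact hle hy'
  have hvanish : ∀ y ∈ good, expect τ y = 0 := fun y hy =>
    (Submodule.span_le (p := LinearMap.ker (expect τ))).2
      (by rintro y ⟨k, hk⟩; exact expect_altWord hS hk) hy
  have htrue : ∀ j y, AltWord (fun b => centred φ (pair C S₂.matrix b)) true j y → y ∈ good :=
    fun j y hy => by simpa using (key _ _ _ hy).1 rfl 1 (Or.inl rfl)
  intro i j y hy
  cases i with
  | true => exact normTrace_eq_zero_of_expect (hvanish y (htrue _ _ hy))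
  -- There is no run to absorb a leading letter over `S₂`. Its scalar part comes out of `expect`,
  -- and its centred part is one more letter in front of words starting in `R true`.
  | false =>
    cases hy with
    | single hx => exact hx.2
    | @cons _ j _ x y hx hij hy =>
      obtain rfl : j = true := Bool.ne_false_iff.1 hij.symm
      have hy' := htrue _ _ hy
      rw [hsplit x hx, add_mul, map_add, hφ,
        normTrace_eq_zero_of_expect (x := const _ * y)
          (by rw [expect_const_mul, hvanish y hy', mul_zero]), add_zero]
      refine normTrace_eq_zero_of_expect ?_
      have hle : good ≤ (LinearMap.ker (expect τ)).comap
          (LinearMap.mulLeft ℂ (x - const (expect τ x))) := by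
        refine Submodule.span_le.2 ?_
        rintro y ⟨k, hk⟩
        exact expect_altWord hS (.cons (i := false) (sub_const_mem_entryCentred h1 hx.1)
          (by simp) hk)
      exact hle hy'

end Matrices

/-- Access to the last letter, needed when traciality moves the first letter to the end. -/
theorem AltWord.eq_or_snoc {ι M : Type*} [Semigroup M] {X : ι → Set M} {i k : ι} {x : M}
    (hx : AltWord X i k x) :
    (i = k ∧ x ∈ X k) ∨ ∃ j y z, AltWord X i j y ∧ j ≠ k ∧ z ∈ X k ∧ x = y * z := by
  induction hx with
  | single hx => exact Or.inl ⟨rfl, hx⟩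
  | @cons i j k x y hx hij _ ih =>
    rcases ih with ⟨rfl, hy⟩ | ⟨l, u, z, hu, hl, hz, rfl⟩
    · exact Or.inr ⟨i, x, y, .single hx, hij, hy, rfl⟩
    · exact Or.inr ⟨l, x * u, z, .cons hx hij hu, hl, hz, (mul_assoc _ _ _).symm⟩

/-! ### A semicircular matrix is free from the scalar matrices -/

section SchwingerDyson

variable {A : Type*} [Ring A] [Algebra ℂ A] {n : ℕ}

/-- The covariance of the entries of a selfadjoint semicircular matrix of variance `h`. -/
def matrixCov (h : ℂ) (p q : Fin n × Fin n) : ℂ := if p.1 = q.2 ∧ p.2 = q.1 then h else 0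

/-- The product of the entries of `w` along a list of indices. -/
def entryProd (w : Matrix (Fin n) (Fin n) A) (l : List (Fin n × Fin n)) : A :=
  (l.map fun p => w p.1 p.2).prod

/-- The entries of `w` form a centred semicircular family with covariance `matrixCov h`. -/
def IsSemicircularMatrix (τ : A →ₗ[ℂ] ℂ) (w : Matrix (Fin n) (Fin n) A) (h : ℂ) : Prop :=
  ∀ l, τ (entryProd w l) = semicircularMoment (matrixCov h) l

/-- The Schwinger-Dyson relation for a matrix `Y`: the expectation of `w_p` times a word in the
entries of `w` times an entry of `Y` is the sum over the contractions of `w_p` with the letters of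
the word, plus the contractions with the letters of `Y`, which are encoded by `ρ`. -/
def SchwingerDyson (τ : A →ₗ[ℂ] ℂ) (w : Matrix (Fin n) (Fin n) A) (h : ℂ)
    (Y : Matrix (Fin n) (Fin n) A)
    (ρ : Matrix (Fin n) (Fin n) A →ₗ[ℂ] Matrix (Fin n) (Fin n) ℂ) : Prop :=
  ∀ (p : Fin n × Fin n) (l : List (Fin n × Fin n)) (i j : Fin n),
    τ (w p.1 p.2 * entryProd w l * Y i j) =
      ∑ k ∈ Finset.range l.length, matrixCov h p (l.getD k p) * τ (entryProd w (l.take k)) *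
        τ (entryProd w (l.drop (k + 1)) * Y i j) +
      h * ρ (Matrix.single p.2 i (entryProd w l)) p.1 j

namespace SchwingerDyson

variable {τ : A →ₗ[ℂ] ℂ} {w Y Z : Matrix (Fin n) (Fin n) A} {h : ℂ}
  {ρ σ : Matrix (Fin n) (Fin n) A →ₗ[ℂ] Matrix (Fin n) (Fin n) ℂ}

/-- For the identity matrix the relation is the recursion of `semicircularMoment` on the partner of
the first letter. -/
theorem one (hw : IsSemicircularMatrix τ w h) : SchwingerDyson τ w h 1 0 := by
  intro p l i j
  by_cases hij : i = j
  · subst hij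
    have h1 := hw (p :: l)
    rw [semicircularMoment] at h1
    simp only [Matrix.one_apply_eq, mul_one, LinearMap.zero_apply, Matrix.zero_apply, mul_zero,
      add_zero]
    refine (h1.trans ?_)
    rw [Finset.sum_range]
    refine Finset.sum_congr rfl fun k _ => ?_
    rw [hw, hw, List.getD_eq_getElem _ _ k.2]
    rfl
  · simp [hij]

theorem sub_smul (hY : SchwingerDyson τ w h Y ρ) (hZ : SchwingerDyson τ w h Z σ) (c : ℂ) :
    SchwingerDyson τ w h (Y - c • Z) (ρ - c • σ) := by
  intro p l i j
  simp only [Matrix.sub_apply, Matrix.smul_apply, mul_sub, map_sub, mul_smul_comm, map_smul,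
    hY p l i j, hZ p l i j, LinearMap.sub_apply, LinearMap.smul_apply, smul_eq_mul,
    Finset.sum_sub_distrib, mul_add, Finset.mul_sum]
  have : ∀ k, c * (matrixCov h p (l.getD k p) * τ (entryProd w (l.take k)) *
      τ (entryProd w (l.drop (k + 1)) * Z i j)) = matrixCov h p (l.getD k p) *
      τ (entryProd w (l.take k)) * (c * τ (entryProd w (l.drop (k + 1)) * Z i j)) :=
    fun k => by ring
  simp only [this]
  ring

/-- A scalar matrix offers nothing to contract with; it only joins the factors that precede the
contracted letter. -/
theorem const_mul (hY : SchwingerDyson τ w h Y ρ) (m : Matrix (Fin n) (Fin n) ℂ) :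
    SchwingerDyson τ w h (const m * Y) (ρ ∘ₗ LinearMap.mulRight ℂ (const m)) := by
  intro p l i j
  have hs : Matrix.single p.2 i (entryProd w l) * const m =
      ∑ a, m i a • Matrix.single p.2 a (entryProd w l) := by
    ext b c
    simp only [Matrix.mul_apply, Matrix.single_apply, Matrix.sum_apply, Matrix.smul_apply,
      const_apply]
    by_cases hb : p.2 = b
    · simp [hb, Algebra.smul_def, Algebra.commutes]
    · simp [hb]
  have hm : ∀ x : A, τ (x * (const m * Y : Matrix (Fin n) (Fin n) A) i j) = ∑ a, m i a * τ (x * Y a j) := fun x => by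
    simp only [Matrix.mul_apply, const_apply, Finset.mul_sum, map_sum, ← Algebra.smul_def,
      mul_smul_comm, map_smul, smul_eq_mul]
  simp only [hm, hY p l, LinearMap.comp_apply, LinearMap.mulRight_apply, hs, map_sum, map_smul,
    Matrix.sum_apply, Matrix.smul_apply, smul_eq_mul, mul_add, Finset.sum_add_distrib,
    Finset.mul_sum]
  rw [Finset.sum_comm]
  congr 1
  · exact Finset.sum_congr rfl fun _ _ => Finset.sum_congr rfl fun _ _ => by ring
  · exact Finset.sum_congr rfl fun _ _ => by ring

/-- The new factor joins the word as one more letter `(i, a)`. Contracting with it closes a trace to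
its left and leaves the expectation of `Y` to its right; the other contractions are those of `Y`
with a longer word. -/
theorem self_mul (hY : SchwingerDyson τ w h Y ρ) :
    SchwingerDyson τ w h (w * Y)
      ((LinearMap.toSpanSingleton ℂ _ (expect τ Y)) ∘ₗ τ ∘ₗ Matrix.traceLinearMap (Fin n) ℂ A +
        ρ ∘ₗ LinearMap.mulRight ℂ w) := by
  intro p l i j
  have hs : Matrix.single p.2 i (entryProd w l) * w =
      ∑ a, Matrix.single p.2 a (entryProd w (l ++ [(i, a)])) := by
    ext b c
    simp only [Matrix.mul_apply, Matrix.single_apply, Matrix.sum_apply, entryProd]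
    by_cases hb : p.2 = b <;> simp [hb]
  have hm : ∀ l' : List (Fin n × Fin n), entryProd w l' * (w * Y) i j =
      ∑ a, entryProd w (l' ++ [(i, a)]) * Y a j := fun l' => by
    simp [Matrix.mul_apply, Finset.mul_sum, entryProd, mul_assoc]
  have hstep : ∀ a, τ (w p.1 p.2 * entryProd w (l ++ [(i, a)]) * Y a j) =
      ∑ k ∈ Finset.range l.length, matrixCov h p (l.getD k p) * τ (entryProd w (l.take k)) *
        τ (entryProd w (l.drop (k + 1) ++ [(i, a)]) * Y a j) +
      matrixCov h p (i, a) * τ (entryProd w l) * τ (Y a j) +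
      h * ρ (Matrix.single p.2 a (entryProd w (l ++ [(i, a)]))) p.1 j := by
    intro a
    rw [hY p (l ++ [(i, a)]) a j, List.length_append, List.length_singleton,
      Finset.sum_range_succ]
    congr 2
    · refine Finset.sum_congr rfl fun k hk => ?_
      have hk := Finset.mem_range.1 hk
      rw [List.getD_append _ _ _ _ hk, List.take_append_of_le_length hk.le,
        List.drop_append_of_le_length hk]
    · simp [entryProd]
  have hdiag : ∑ a, matrixCov h p (i, a) * τ (entryProd w l) * τ (Y a j) =
      h * (τ ((Matrix.single p.2 i (entryProd w l)).trace) • expect τ Y) p.1 j := by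
    by_cases hpi : p.2 = i
    · rw [Finset.sum_eq_single p.1]
      · simp [matrixCov, hpi, expect_apply]; ring
      · intro b _ hb; simp [matrixCov, hb.symm]
      · simp
    · simp [matrixCov, hpi, Matrix.trace_single_eq_of_ne]
  rw [mul_assoc, hm, Finset.mul_sum, map_sum]
  simp only [← mul_assoc, hstep, hm, map_sum, Finset.mul_sum, LinearMap.add_apply,
    LinearMap.comp_apply, Matrix.add_apply, LinearMap.mulRight_apply, hs, Matrix.sum_apply,
    Finset.sum_add_distrib, mul_add, hdiag, LinearMap.toSpanSingleton_apply,
    Matrix.traceLinearMap_apply]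
  rw [Finset.sum_comm, add_assoc]

/-- The case of the empty word, with `1` resolved into diagonal matrix units to sum over the inner
index. -/
theorem expect_self_mul (hY : SchwingerDyson τ w h Y ρ) : expect τ (w * Y) = h • ρ 1 := by
  ext i j
  have h1 : (1 : Matrix (Fin n) (Fin n) A) = ∑ a, Matrix.single a a 1 := by
    ext b c
    by_cases hbc : b = c
    · subst hbc; simp [Matrix.sum_apply, Matrix.single_apply]
    · rw [Matrix.one_apply_ne hbc, Matrix.sum_apply, Finset.sum_eq_zero]
      exact fun d _ => Matrix.single_apply_of_ne _ _ _ _ _ fun h => hbc (h.1.symm.trans h.2)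
  rw [h1, map_sum]
  simp only [expect_apply, Matrix.mul_apply, map_sum, Matrix.smul_apply, Matrix.sum_apply,
    smul_eq_mul, Finset.mul_sum]
  refine Finset.sum_congr rfl fun a _ => ?_
  simpa [entryProd] using hY (i, a) [] a j

/-- Iteration of `self_mul`: the summand `j` contracts with the factor of `w ^ k` that has `w ^ j`
on its left and `w ^ (k - 1 - j)` on its right. -/
theorem pow_mul (hY : SchwingerDyson τ w h Y ρ) (k : ℕ) :
    ∃ σ, SchwingerDyson τ w h (w ^ k * Y) σ ∧ ∀ y, σ y =
      ∑ j ∈ Finset.range k, τ (y * w ^ j).trace • expect τ (w ^ (k - 1 - j) * Y) +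
        ρ (y * w ^ k) := by
  induction k with
  | zero => exact ⟨ρ, by simpa using hY, by simp⟩
  | succ k ih =>
    obtain ⟨σ, hσ, hσy⟩ := ih
    refine ⟨_, by simpa only [pow_succ', mul_assoc] using hσ.self_mul, fun y => ?_⟩
    simp only [LinearMap.add_apply, LinearMap.comp_apply, LinearMap.mulRight_apply, hσy,
      LinearMap.toSpanSingleton_apply, Matrix.traceLinearMap_apply]
    rw [Finset.sum_range_succ']
    simp only [mul_assoc, ← pow_succ', pow_zero, mul_one, Nat.add_sub_cancel, Nat.sub_zero]
    rw [add_comm (Finset.sum _ _) (τ y.trace • _), ← add_assoc]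
    congr 2
    exact Finset.sum_congr rfl fun j _ => by rw [Nat.sub_sub, Nat.add_comm]

end SchwingerDyson

/-- The letters `w^k - φ(w^k)` with `k ≥ 1`, and the traceless scalar matrices, together with
their degree in `w`. -/
def powerLetters (φ : Matrix (Fin n) (Fin n) A →ₗ[ℂ] ℂ) (w : Matrix (Fin n) (Fin n) A) (b : Bool) :
    Set (Matrix (Fin n) (Fin n) A × Multiplicative ℕ) :=
  cond b {x | ∃ k : ℕ, 1 ≤ k ∧ x = (w ^ k - φ (w ^ k) • 1, .ofAdd k)}
    {x | ∃ m : Matrix (Fin n) (Fin n) ℂ, φ (const m) = 0 ∧ x = (const m, 1)}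

variable {τ : A →ₗ[ℂ] ℂ} {w : Matrix (Fin n) (Fin n) A} {h : ℂ}

/-- Strong induction on the degree in `w`. If the first letter is a power, its leading `w` is
contracted with every other factor `w`; each contraction splits the word into two pieces, and one of
them has trace zero by induction. If the first letter is scalar, traciality reduces to the previous
case. -/
theorem normTrace_altWord_pow [NeZero n] (h1 : τ 1 = 1) (hτ : ∀ a b, τ (a * b) = τ (b * a))
    (hw : IsSemicircularMatrix τ w h) {i j : Bool} {z : Matrix (Fin n) (Fin n) A × Multiplicative ℕ}
    (hz : AltWord (powerLetters (normTrace τ) w) i j z) : normTrace τ z.1 = 0 := by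
  set φ : Matrix (Fin n) (Fin n) A →ₗ[ℂ] ℂ := normTrace τ with hφ
  set X := powerLetters φ w with hX
  have hφ1 : φ 1 = 1 := normTrace_one h1
  have hψ : ∀ x, τ x.trace = n * φ x := fun x => by
    simp [hφ, normTrace, NeZero.ne n]
  have hsingle : ∀ i, ∀ x ∈ X i, φ x.1 = 0 := by
    rintro (_ | _) x hx
    · obtain ⟨m, hm, rfl⟩ := hx; exact hm
    · obtain ⟨k, -, rfl⟩ := hx; simp [hφ1]
  induction hd : z.2.toAdd using Nat.strong_induction_on generalizing i j z with
  | _ d IH =>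
  subst hd
  -- The contractions of a letter on the left with an alternating word.
  have step : ∀ i, ∀ x ∈ X i, ∀ Y ρ e, SchwingerDyson τ w h Y ρ →
      (∀ a pre, AltWord X a i pre → pre.2.toAdd + e ≤ z.2.toAdd → ρ pre.1 = 0) →
      ∃ σ, SchwingerDyson τ w h (x.1 * Y) σ ∧
        ∀ pre, ((pre = 1 ∧ i = false) ∨ ∃ a b, AltWord X a b pre ∧ b ≠ i) →
          pre.2.toAdd + (x.2.toAdd + e) ≤ z.2.toAdd → σ pre.1 = 0 := by
    rintro (_ | _) x hx Y ρ e hY hρ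
    · have hx' := hx
      obtain ⟨m, hm, rfl⟩ := hx
      refine ⟨_, hY.const_mul m, ?_⟩
      rintro pre (⟨rfl, -⟩ | ⟨a, b, hab, hb⟩) hdeg
      · simpa using hρ false _ (.single hx') (by simpa using hdeg)
      · simpa using hρ a _ (hab.append hb (.single hx')) (by simpa using hdeg)
    · have hx' := hx
      obtain ⟨k, hk, rfl⟩ := hx
      obtain ⟨σ, hσ, hσy⟩ := hY.pow_mul k
      refine ⟨σ - φ (w ^ k) • ρ, by simpa [sub_mul] using hσ.sub_smul hY (φ (w ^ k)), ?_⟩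
      rintro pre (⟨-, hf⟩ | ⟨a, b, hab, hb⟩) hdeg
      · cases hf
      have hprod := hρ a _ (hab.append hb (.single hx')) (by simpa [add_assoc] using hdeg)
      simp only [Prod.fst_mul, mul_sub, mul_smul_comm, mul_one, map_sub, map_smul] at hprod
      rw [LinearMap.sub_apply, hσy, LinearMap.smul_apply, add_sub_assoc, hprod, add_zero]
      -- A contraction inside this letter leaves the trace of `pre * w ^ j` with `j < k`. Centring
      -- `w ^ j` turns it into a combination of alternating words of smaller degree; for `j = 0`
      -- only `pre` remains.
      refine Finset.sum_eq_zero fun j hj => ?_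
      have hj := Finset.mem_range.1 hj
      simp only [toAdd_ofAdd] at hdeg
      have hpre : φ pre.1 = 0 := IH _ (by omega) hab rfl
      rw [hψ]
      rcases Nat.eq_zero_or_pos j with rfl | hj0
      · simp [hpre]
      · have := IH _ (by simp only [Prod.snd_mul, toAdd_mul, toAdd_ofAdd]; omega)
          (hab.append hb (.single (i := true) ⟨j, hj0, rfl⟩)) rfl
        simp only [Prod.fst_mul, mul_sub, mul_smul_comm, mul_one, map_sub, map_smul, hpre,
          smul_zero, sub_zero] at this
        simp [this]
  have hright : ∀ i j y, AltWord X i j y → ∃ σ, SchwingerDyson τ w h y.1 σ ∧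
      ∀ pre, ((pre = 1 ∧ i = false) ∨ ∃ a b, AltWord X a b pre ∧ b ≠ i) →
        pre.2.toAdd + y.2.toAdd ≤ z.2.toAdd → σ pre.1 = 0 := by
    intro i j y hy
    induction hy with
    | @single i x hx =>
      simpa using step i x hx 1 0 0 (SchwingerDyson.one hw) (by simp)
    | @cons i j k x y hx hij hy ih =>
      obtain ⟨ρ, hρ, hρ'⟩ := ih
      obtain ⟨σ, hσ, hσ'⟩ := step i x hx y.1 ρ y.2.toAdd hρ
        fun a pre hpre hdeg => hρ' pre (Or.inr ⟨a, i, hpre, hij⟩) hdeg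
      exact ⟨σ, hσ, fun pre hpre hdeg => hσ' pre hpre (by simpa using hdeg)⟩
  -- Stated for all words of the given degree, because a scalar first letter will be handled by
  -- rotating to another word of that degree.
  have htrue : ∀ j y, AltWord X true j y → y.2.toAdd = z.2.toAdd → φ y.1 = 0 := by
    intro j y hy hdeg
    cases hy with
    | single hx => exact hsingle _ _ hx
    | @cons _ j _ x y hx hij hy =>
      obtain rfl : j = false := Bool.eq_false_iff.2 hij.symm
      obtain ⟨k, hk, rfl⟩ := hx
      obtain ⟨k, rfl⟩ := Nat.exists_eq_add_of_le' hk
      simp only [Prod.snd_mul, toAdd_mul, toAdd_ofAdd] at hdeg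
      have hy0 : φ y.1 = 0 := IH _ (by omega) hy rfl
      obtain ⟨ρ, hρ, hρ'⟩ := hright _ _ _ hy
      obtain ⟨σ, hσ, hσy⟩ := hρ.pow_mul k
      have hpow : ∀ a ≤ k, ((w ^ a - φ (w ^ a) • 1) * y.1 ∈ LinearMap.ker φ) ∧
          ρ (w ^ a) = 0 := by
        intro a ha
        have hρ1 : ρ 1 = 0 := hρ' 1 (Or.inl ⟨rfl, rfl⟩) (by rw [Prod.snd_one, toAdd_one]; omega)
        rcases Nat.eq_zero_or_pos a with rfl | ha0
        · simp [hφ1, hρ1]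
        · have hl : ((w ^ a - φ (w ^ a) • 1, .ofAdd a) :
              Matrix (Fin n) (Fin n) A × Multiplicative ℕ) ∈ X true := ⟨a, ha0, rfl⟩
          refine ⟨IH _ ?_ (AltWord.cons hl hij hy) rfl, ?_⟩
          · simp only [Prod.snd_mul, toAdd_mul, toAdd_ofAdd]; omega
          · have := hρ' _ (Or.inr ⟨true, true, .single hl, by simp⟩)
              (by simp only [toAdd_ofAdd]; omega)
            simpa [hρ1] using this
      have hφpow : ∀ a ≤ k, φ (w ^ a * y.1) = 0 := fun a ha => by
        simpa [sub_mul, hy0] using (hpow a ha).1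
      -- Contractions of the leading `w` inside `w ^ k` produce the traces of `w ^ (k - 1 - j) * y`,
      -- zero by induction; contractions with `y` are collected in `ρ (w ^ k) = 0`.
      have hmain : φ (w * (w ^ k * y.1)) = 0 := by
        rw [hφ, normTrace_eq_trace_expect, hσ.expect_self_mul, hσy]
        simp only [one_mul, (hpow k le_rfl).2, add_zero, Matrix.trace_smul, Matrix.trace_sum]
        rw [Finset.sum_eq_zero, smul_zero, mul_zero]
        intro j hj
        have := hφpow (k - 1 - j) (by omega)
        rw [hφ, normTrace_eq_trace_expect] at this
        rw [(mul_eq_zero.1 this).resolve_left (by simp [NeZero.ne n]), smul_zero]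
      rw [← mul_assoc, ← pow_succ'] at hmain
      simp [sub_mul, hmain, hy0]
  cases i with
  | true => exact htrue _ _ hz rfl
  | false =>
    cases hz with
    | single hx => exact hsingle _ _ hx
    | @cons _ i _ x y hx hij hy =>
      obtain rfl : i = true := Bool.ne_false_iff.1 hij.symm
      have hx' := hx
      obtain ⟨m, hm, rfl⟩ := hx
      change φ (const m * y.1) = 0
      -- The scalar letter moves to the end at no cost in degree. There it is a new last letter, or
      -- it merges with a final scalar letter and the product is recentred.
      rw [hφ, normTrace_mul_comm hτ, ← hφ]
      cases j with
      | true => exact htrue _ _ (hy.append (by simp) (.single hx')) (by simp)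
      | false =>
        rcases hy.eq_or_snoc with ⟨h, -⟩ | ⟨j, u, v, hu, hj, ⟨m', -, rfl⟩, rfl⟩
        · cases h
        · obtain rfl : j = true := Bool.ne_false_iff.1 hj
          have e1 := htrue _ _ hu (by simp)
          have e2 := htrue _ _ (hu.append hj (.single (i := false)
            ⟨m' * m - φ (const (m' * m)) • 1, by simp [hφ1], rfl⟩)) (by simp)
          simp only [Prod.fst_mul, map_sub, map_mul, map_smul, map_one, mul_sub, mul_smul_comm,
            mul_one, e1, smul_zero, sub_zero] at e2
          simpa [mul_assoc] using e2

/-- The algebra generated by a semicircular matrix is free from the scalar matrices. -/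
theorem freeFamily_adjoin_semicircular [NeZero n] (h1 : τ 1 = 1)
    (hτ : ∀ a b, τ (a * b) = τ (b * a)) (hw : IsSemicircularMatrix τ w h) :
    FreeFamily (normTrace τ) (pair (Algebra.adjoin ℂ {w}) (scalars A n)) := by
  set φ : Matrix (Fin n) (Fin n) A →ₗ[ℂ] ℂ := normTrace τ with hφ
  refine FreeFamily.of_span (fun b => Prod.fst '' powerLetters φ w b) ?_ ?_
  · rintro (_ | _) x hx
    · obtain ⟨⟨m, rfl⟩, hm⟩ := hx
      exact Submodule.subset_span ⟨_, ⟨m, hm, rfl⟩, rfl⟩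
    · obtain ⟨hx, hx0⟩ := hx
      change x ∈ Algebra.adjoin ℂ {w} at hx
      rw [Algebra.adjoin_singleton_eq_range_aeval] at hx
      obtain ⟨p, rfl⟩ := hx
      change φ (Polynomial.aeval w p) = 0 at hx0
      suffices hp : ∀ p : Polynomial ℂ, Polynomial.aeval w p - φ (Polynomial.aeval w p) • 1 ∈
          Submodule.span ℂ (Prod.fst '' powerLetters φ w true) by
        have := hp p
        rwa [hx0, zero_smul, sub_zero] at this
      intro p
      induction p using Polynomial.induction_on' with
      | add p q hp hq =>
        have := add_mem hp hq
        convert this using 1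
        simp only [map_add, add_smul]; abel
      | monomial k c =>
        rcases Nat.eq_zero_or_pos k with rfl | hk
        · have hφ1 : φ 1 = 1 := normTrace_one h1
          simp [Algebra.algebraMap_eq_smul_one, hφ1]
        · have := Submodule.smul_mem _ c (Submodule.subset_span (R := ℂ)
            (s := Prod.fst '' powerLetters φ w true) ⟨_, ⟨k, hk, rfl⟩, rfl⟩)
          simpa [Polynomial.aeval_monomial, ← Algebra.smul_def, smul_sub, smul_smul] using this
  · intro i j x hx
    suffices ∃ d, AltWord (powerLetters φ w) i j (x, d) by
      obtain ⟨d, hd⟩ := this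
      exact normTrace_altWord_pow h1 hτ hw hd
    induction hx with
    | single hx =>
      obtain ⟨⟨x, d⟩, hx, rfl⟩ := hx
      exact ⟨d, .single hx⟩
    | cons hx hij _ ih =>
      obtain ⟨⟨x, d⟩, hx, rfl⟩ := hx
      obtain ⟨e, he⟩ := ih
      exact ⟨d * e, .cons hx hij he⟩

end SchwingerDyson

/-! ### Freeness along increasing unions -/

section Words

variable {M : Type*} [Ring M] [Algebra ℂ M] {φ : M →ₗ[ℂ] ℂ} {D : Subalgebra ℂ M}

theorem centred_pair_mono {C C' : Subalgebra ℂ M} (h : C ≤ C') (i : Bool) :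
    centred φ (pair C D i) ⊆ centred φ (pair C' D i) := by
  cases i
  exacts [fun _ hx => hx, fun _ hx => ⟨h hx.1, hx.2⟩]

theorem FreeFamily.mono_left {C C' : Subalgebra ℂ M} (hC : FreeFamily φ (pair C D))
    (h : C' ≤ C) : FreeFamily φ (pair C' D) :=
  FreeFamily.mono hC fun i => by cases i; exacts [le_rfl, h]

/-- A word has finitely many letters, so a single member of the increasing family contains all those
it needs. -/
theorem FreeFamily.iSup_left {C : ℕ → Subalgebra ℂ M} (hmono : Monotone C)
    (hC : ∀ m, FreeFamily φ (pair (C m) D)) : FreeFamily φ (pair (⨆ m, C m) D) := by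
  intro i j x hx
  have hfin : ∀ i, ∀ y ∈ centred φ (pair (⨆ m, C m) D i), ∃ m, y ∈ centred φ (pair (C m) D i) := by
    rintro (_ | _) y ⟨hy, hy0⟩
    · exact ⟨0, hy, hy0⟩
    · change y ∈ ⨆ m, C m at hy
      rw [← SetLike.mem_coe, Subalgebra.coe_iSup_of_directed hmono.directed_le,
        Set.mem_iUnion] at hy
      obtain ⟨m, hm⟩ := hy
      exact ⟨m, hm, hy0⟩
  obtain ⟨m, hm⟩ : ∃ m, AltWord (fun i => centred φ (pair (C m) D i)) i j x := by
    induction hx with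
    | single hx =>
      obtain ⟨m, hm⟩ := hfin _ _ hx
      exact ⟨m, .single hm⟩
    | cons hx hij _ ih =>
      obtain ⟨m, hm⟩ := hfin _ _ hx
      obtain ⟨m', hm'⟩ := ih
      exact ⟨max m m', .cons (centred_pair_mono (hmono (le_max_left _ _)) _ hm) hij
        (hm'.mono (centred_pair_mono (hmono (le_max_right _ _))))⟩
  exact hC m _ _ _ hm

end Words

/-! ### The algebra of a matrix of free Brownian noise -/

section Noise

variable {A : Type*} [CStarAlgebra A] {n : ℕ} {τ : A →ₗ[ℂ] ℂ}

theorem IsFreePair.freeFamily {B C : StarSubalgebra ℂ A} (h : IsFreePair τ B C) :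
    FreeFamily τ (pair B.toSubalgebra C.toSubalgebra) := by
  intro i j x hx
  suffices ∃ l : List (Bool × A), (∃ a l', l = (i, a) :: l') ∧
      (∀ p ∈ l, p.2 ∈ centred τ (pair B.toSubalgebra C.toSubalgebra p.1)) ∧
      l.IsChain (fun p q => p.1 ≠ q.1) ∧ (l.map Prod.snd).prod = x by
    obtain ⟨l, ⟨a, l', hl⟩, hmem, hchain, rfl⟩ := this
    refine h l (by simp [hl]) (fun p hp => ⟨?_, (hmem p hp).2⟩) hchain
    have := (hmem p hp).1
    revert this
    rcases p with ⟨_ | _, p⟩ <;> exact id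
  induction hx with
  | @single i x hx => exact ⟨[(i, x)], ⟨x, [], rfl⟩, by simpa using hx, by simp, by simp⟩
  | @cons i j k x y hx hij hy ih =>
    obtain ⟨l, ⟨a, l', rfl⟩, hmem, hchain, hprod⟩ := ih
    refine ⟨(i, x) :: (j, a) :: l', ⟨x, _, rfl⟩, ?_, ?_, by simp [← hprod]⟩
    · intro p hp
      rcases List.mem_cons.1 hp with rfl | hp
      exacts [hx, hmem p hp]
    · exact List.isChain_cons_cons.2 ⟨hij, hchain⟩

theorem mem_entryAlg (x : Matrix (Fin n) (Fin n) A) (i j : Fin n) : x i j ∈ entryAlg x :=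
  StarAlgebra.subset_adjoin ℂ _ ⟨i, j, rfl⟩

theorem mem_matrix_entryAlg (x : Matrix (Fin n) (Fin n) A) :
    x ∈ (entryAlg x).toSubalgebra.matrix := fun i j => mem_entryAlg x i j

variable {F : ℝ → StarSubalgebra ℂ A} {W : ℝ → Matrix (Fin n) (Fin n) A}

theorem IsMatrixFreeBM.isSemicircularMatrix (hW : IsMatrixFreeBM τ F W) {s t : ℝ} (hs : 0 ≤ s)
    (hst : s ≤ t) : IsSemicircularMatrix τ (W t - W s) ((t - s : ℝ) : ℂ) := by
  intro l
  have h := hW.semicircular s t hs hst l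
  have hC : matrixCov ((t - s : ℝ) : ℂ) = fun p q : Fin n × Fin n =>
      if p.1 = q.2 ∧ p.2 = q.1 then ((t - s : ℝ) : ℂ) else 0 := rfl
  rw [hC, entryProd, h]

/-- The algebra generated by the noise at finitely many times is free from the scalar matrices. -/
theorem IsMatrixFreeBM.freeFamily_adjoin [NeZero n] (hτ : IsTracialState τ)
    (hF : ∀ s t, 0 ≤ s → s ≤ t → F s ≤ F t) (hW : IsMatrixFreeBM τ F W) {p : ℕ → ℝ}
    (hp0 : p 0 = 0) (hp : Monotone p) (k : ℕ) :
    FreeFamily (normTrace τ) (pair (Algebra.adjoin ℂ {x | ∃ j ≤ k, x = W (p j)})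
      (scalars A n)) := by
  have hpos : ∀ k, 0 ≤ p k := fun k => hp0 ▸ hp (Nat.zero_le k)
  induction k with
  | zero =>
    -- The zero matrix, seen as a semicircular increment of variance `0`.
    have : {x | ∃ j ≤ 0, x = W (p j)} = {W 0 - W 0} := by
      ext x; simp [hp0, hW.zero]
    rw [this]
    exact freeFamily_adjoin_semicircular hτ.map_one hτ.tracial
      (hW.isSemicircularMatrix le_rfl le_rfl)
  | succ k ih =>
    set w := W (p (k + 1)) - W (p k) with hw
    -- Freeness of the past from the scalars lifts to freeness from all matrices over the entries of
    -- the new increment. These contain both the increment and the scalars, which is what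
    -- associativity of freeness requires.
    have hsup := freeFamily_sup (normTrace_one hτ.map_one)
      (freeFamily_matrix (n := n) hτ.map_one
        (hW.free (p k) (p (k + 1)) (hpos k) (hp k.le_succ)).freeFamily
        (C := Algebra.adjoin ℂ {x | ∃ j ≤ k, x = W (p j)}) ?_ ih)
      (C₂ := Algebra.adjoin ℂ {w})
      (Algebra.adjoin_le (Set.singleton_subset_iff.2 (mem_matrix_entryAlg w)))
      (scalars_le_matrix _)
      (freeFamily_adjoin_semicircular hτ.map_one hτ.tracial
        (hW.isSemicircularMatrix (hpos k) (hp k.le_succ)))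
    · refine hsup.mono_left (Algebra.adjoin_le ?_)
      · have hmem : ∀ j ≤ k, W (p j) ∈ Algebra.adjoin ℂ {x | ∃ j ≤ k, x = W (p j)} ⊔
            Algebra.adjoin ℂ {w} := fun j hj =>
          (le_sup_left : _ ≤ _ ⊔ Algebra.adjoin ℂ {w}) (Algebra.subset_adjoin ⟨j, hj, rfl⟩)
        rintro _ ⟨j, hj, rfl⟩
        rcases hj.lt_or_eq with hj | rfl
        · exact hmem j (Nat.lt_succ_iff.1 hj)
        · have hw' : w ∈ Algebra.adjoin ℂ {x | ∃ j ≤ k, x = W (p j)} ⊔ Algebra.adjoin ℂ {w} :=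
            (le_sup_right : Algebra.adjoin ℂ {w} ≤ _) (Algebra.subset_adjoin rfl)
          have := add_mem hw' (hmem k le_rfl)
          rwa [hw, sub_add_cancel] at this
    · refine Algebra.adjoin_le ?_
      rintro _ ⟨j, hj, rfl⟩ a b
      exact hF _ _ (hpos j) (hp hj) (hW.adapted _ (hpos j) a b)

/-- The algebra generated by the noise at the dyadic times of generation `m` in `[0, T]`. -/
def dyadicAlg (W : ℝ → Matrix (Fin n) (Fin n) A) (T : ℝ) (m : ℕ) :
    Subalgebra ℂ (Matrix (Fin n) (Fin n) A) :=
  Algebra.adjoin ℂ {x | ∃ j : ℕ, j ≤ 2 ^ m ∧ x = W (j * (T / 2 ^ m))}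

/-- Nested grids are the reason for choosing dyadic times: the union over all generations is then a
directed one. -/
theorem dyadicAlg_mono (W : ℝ → Matrix (Fin n) (Fin n) A) (T : ℝ) :
    Monotone (dyadicAlg W T) := by
  refine monotone_nat_of_le_succ fun m => Algebra.adjoin_mono ?_
  rintro _ ⟨j, hj, rfl⟩
  refine ⟨2 * j, by rw [pow_succ]; omega, ?_⟩
  congr 1
  push_cast
  field_simp
  ring

theorem star_mem_dyadicAlg (hW : IsMatrixFreeBM τ F W) {T : ℝ} (hT : 0 ≤ T) (m : ℕ)
    {x : Matrix (Fin n) (Fin n) A} (hx : x ∈ dyadicAlg W T m) : star x ∈ dyadicAlg W T m := by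
  rw [← Subalgebra.mem_star_iff, dyadicAlg, Subalgebra.star_adjoin_comm]
  convert hx using 2
  rw [dyadicAlg]
  congr 1
  ext y
  have hs : ∀ j : ℕ, star (W (j * (T / 2 ^ m))) = W (j * (T / 2 ^ m)) := fun j =>
    hW.selfAdjoint _ (by positivity)
  constructor
  · rintro ⟨j, hj, h⟩; exact ⟨j, hj, by rw [← hs, ← h, star_star]⟩
  · rintro ⟨j, hj, rfl⟩; exact ⟨j, hj, hs j⟩

theorem IsMatrixFreeBM.freeFamily_dyadic [NeZero n] (hτ : IsTracialState τ)
    (hF : ∀ s t, 0 ≤ s → s ≤ t → F s ≤ F t) (hW : IsMatrixFreeBM τ F W) {T : ℝ} (hT : 0 ≤ T) :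
    FreeFamily (normTrace τ) (pair (⨆ m, dyadicAlg W T m) (scalars A n)) := by
  refine FreeFamily.iSup_left (dyadicAlg_mono W T) fun m => ?_
  have hmonoT : Monotone fun j : ℕ => (j : ℝ) * (T / 2 ^ m) := fun a b h => by
    have : (a : ℝ) ≤ b := by exact_mod_cast h
    dsimp only; gcongr
  exact hW.freeFamily_adjoin hτ hF (by simp) hmonoT (2 ^ m)

end Noise

/-! ### The `L²` seminorm of a tracial functional -/

section L2

variable {M : Type*} [Ring M] [StarRing M] [Algebra ℂ M]

/-- A tracial state for which multiplication operators are bounded in `L²`. -/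
structure IsBoundedTrace (φ : M →ₗ[ℂ] ℂ) : Prop where
  map_one : φ 1 = 1
  nonneg : ∀ a, 0 ≤ φ (star a * a)
  tracial : ∀ a b, φ (a * b) = φ (b * a)
  bounded : ∀ a, ∃ K : ℝ, 0 ≤ K ∧ ∀ y, (φ (star (a * y) * (a * y))).re ≤ K * (φ (star y * y)).re

/-- The `L²` seminorm. -/
noncomputable def norm2 (φ : M →ₗ[ℂ] ℂ) (x : M) : ℝ := √(φ (star x * x)).re

theorem norm2_nonneg (φ : M →ₗ[ℂ] ℂ) (x : M) : 0 ≤ norm2 φ x := Real.sqrt_nonneg _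

theorem norm2_neg (φ : M →ₗ[ℂ] ℂ) (x : M) : norm2 φ (-x) = norm2 φ x := by simp [norm2]

theorem norm2_zero (φ : M →ₗ[ℂ] ℂ) : norm2 φ (0 : M) = 0 := by simp [norm2]

variable [StarModule ℂ M]

/-- Polarisation: reality at `x + y` compares the imaginary parts, reality at `x + Complex.I • y`
the real parts. -/
theorem map_star_of_nonneg {φ : M →ₗ[ℂ] ℂ} (h : ∀ a, 0 ≤ φ (star a * a)) (x y : M) :
    φ (star y * x) = starRingEnd ℂ (φ (star x * y)) := by
  have him : ∀ a, (φ (star a * a)).im = 0 := fun a => (Complex.nonneg_iff.1 (h a)).2.symm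
  have e1 := him (x + y)
  have e2 := him (x + Complex.I • y)
  simp only [star_add, star_smul, add_mul, mul_add, map_add, Complex.add_im, him, smul_mul_assoc,
    mul_smul_comm, map_smul, smul_eq_mul, Complex.mul_im, Complex.mul_re, RCLike.star_def,
    Complex.conj_I, Complex.neg_re, Complex.neg_im, Complex.I_re, Complex.I_im] at e1 e2
  apply Complex.ext
  · simp only [Complex.conj_re]; linarith
  · simp only [Complex.conj_im]; linarith

/-- The pre-inner product `⟨x, y⟩ = φ(x* y)`. -/
@[reducible] def preInner {φ : M →ₗ[ℂ] ℂ} (h : ∀ a, 0 ≤ φ (star a * a)) :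
    PreInnerProductSpace.Core ℂ M where
  inner x y := φ (star x * y)
  conj_inner_symm x y := (map_star_of_nonneg h y x).symm
  re_inner_nonneg x := (Complex.nonneg_iff.1 (h x)).1
  add_left x y z := by simp [add_mul]
  smul_left x y c := by simp

namespace IsBoundedTrace

variable {φ : M →ₗ[ℂ] ℂ} (hφ : IsBoundedTrace φ)
include hφ

theorem ofReal_norm2_sq (x : M) : ((norm2 φ x ^ 2 : ℝ) : ℂ) = φ (star x * x) := by
  have := Complex.nonneg_iff.1 (hφ.nonneg x)
  rw [norm2, Real.sq_sqrt this.1]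
  exact Complex.ext rfl this.2

theorem norm2_sq (x : M) : norm2 φ x ^ 2 = (φ (star x * x)).re := by
  rw [← hφ.ofReal_norm2_sq, Complex.ofReal_re]

theorem norm2_add_le (x y : M) : norm2 φ (x + y) ≤ norm2 φ x + norm2 φ y := by
  let := InnerProductSpace.Core.toSeminormedAddCommGroup (c := preInner hφ.nonneg)
  exact norm_add_le x y

theorem norm2_sub_le (x y : M) : norm2 φ (x - y) ≤ norm2 φ x + norm2 φ y := by
  simpa [sub_eq_add_neg, norm2_neg] using hφ.norm2_add_le x (-y)

theorem norm2_smul (c : ℂ) (x : M) : norm2 φ (c • x) = ‖c‖ * norm2 φ x := by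
  let := InnerProductSpace.Core.toSeminormedAddCommGroup (c := preInner hφ.nonneg)
  let := InnerProductSpace.Core.toNormedSpace (c := preInner hφ.nonneg)
  exact norm_smul c x

theorem norm2_star (x : M) : norm2 φ (star x) = norm2 φ x := by
  rw [norm2, norm2, star_star, hφ.tracial]

theorem norm2_one : norm2 φ (1 : M) = 1 := by simp [norm2, hφ.map_one]

theorem norm_map_mul_le (x y : M) : ‖φ (x * y)‖ ≤ norm2 φ x * norm2 φ y := by
  let := preInner hφ.nonneg
  have := InnerProductSpace.Core.norm_inner_le_norm (𝕜 := ℂ) (star x) y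
  rw [← hφ.norm2_star x]
  refine (le_of_eq ?_).trans this
  change _ = ‖φ (star (star x) * y)‖
  rw [star_star]

theorem norm_map_le (x : M) : ‖φ x‖ ≤ norm2 φ x := by
  simpa [hφ.norm2_one] using hφ.norm_map_mul_le 1 x

theorem norm2_mul_le (a : M) : ∃ K : ℝ, 0 ≤ K ∧ ∀ y, norm2 φ (a * y) ≤ K * norm2 φ y := by
  obtain ⟨K, hK, h⟩ := hφ.bounded a
  refine ⟨√K, Real.sqrt_nonneg _, fun y => ?_⟩
  rw [norm2, norm2, ← Real.sqrt_mul hK]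
  exact Real.sqrt_le_sqrt (h y)

theorem norm2_mul_le_right (a : M) : ∃ K : ℝ, 0 ≤ K ∧ ∀ y, norm2 φ (y * a) ≤ K * norm2 φ y := by
  obtain ⟨K, hK, h⟩ := hφ.norm2_mul_le (star a)
  refine ⟨K, hK, fun y => ?_⟩
  rw [← hφ.norm2_star, star_mul, ← hφ.norm2_star y]
  exact h _

theorem norm2_add_sq {x y : M} (h : φ (star x * y) = 0) :
    norm2 φ (x + y) ^ 2 = norm2 φ x ^ 2 + norm2 φ y ^ 2 := by
  have h' : φ (star y * x) = 0 := by rw [map_star_of_nonneg hφ.nonneg, h, map_zero]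
  simp [hφ.norm2_sq, add_mul, mul_add, h, h']

/-- The `L²` closure of a subalgebra. -/
def l2Closure (C : Subalgebra ℂ M) : Subalgebra ℂ M where
  carrier := {x | ∀ ε > 0, ∃ c ∈ C, norm2 φ (x - c) < ε}
  algebraMap_mem' r ε hε := ⟨_, C.algebraMap_mem r, by simpa [norm2_zero] using hε⟩
  add_mem' {x y} hx hy ε hε := by
    obtain ⟨c, hc, hxc⟩ := hx (ε / 2) (half_pos hε)
    obtain ⟨d, hd, hyd⟩ := hy (ε / 2) (half_pos hε)
    refine ⟨c + d, add_mem hc hd, ?_⟩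
    have := hφ.norm2_add_le (x - c) (y - d)
    rw [add_sub_add_comm]
    linarith
  mul_mem' {x y} hx hy ε hε := by
    -- The order of choices matters: `d` is fitted to the bound for `x`, then `c` to the bound for
    -- `d`. No uniform operator bound on approximants is available.
    obtain ⟨K, hK, hKx⟩ := hφ.norm2_mul_le x
    obtain ⟨d, hd, hyd⟩ := hy (ε / 2 / (K + 1)) (by positivity)
    obtain ⟨L, hL, hLd⟩ := hφ.norm2_mul_le_right d
    obtain ⟨c, hc, hxc⟩ := hx (ε / 2 / (L + 1)) (by positivity)
    refine ⟨c * d, mul_mem hc hd, ?_⟩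
    have h1 := hφ.norm2_add_le (x * (y - d)) ((x - c) * d)
    have h2 := hKx (y - d)
    have h3 := hLd (x - c)
    have h4 : x * (y - d) + (x - c) * d = x * y - c * d := by noncomm_ring
    rw [h4] at h1
    rw [lt_div_iff₀ (by positivity)] at hyd hxc
    nlinarith [norm2_nonneg φ (y - d), norm2_nonneg φ (x - c)]

theorem star_mem_l2Closure {C : Subalgebra ℂ M} (hC : ∀ c ∈ C, star c ∈ C) {x : M}
    (hx : x ∈ hφ.l2Closure C) : star x ∈ hφ.l2Closure C := fun ε hε => by
  obtain ⟨c, hc, h⟩ := hx ε hε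
  exact ⟨star c, hC c hc, by rwa [← star_sub, hφ.norm2_star]⟩

/-- Freeness passes to the `L²` closure of one of the two algebras. -/
theorem freeFamily_l2Closure {C D : Subalgebra ℂ M} (h : FreeFamily φ (pair C D)) :
    FreeFamily φ (pair (hφ.l2Closure C) D) := by
  set X := fun b => centred φ (pair C D b) with hX
  -- A single letter may be replaced by a centred approximant: by traciality the other factors form
  -- one fixed element `b * a`, and Cauchy-Schwarz applies.
  have approx : ∀ i, ∀ x ∈ centred φ (pair (hφ.l2Closure C) D i), ∀ a b : M,
      (∀ c ∈ X i, φ (a * c * b) = 0) → φ (a * x * b) = 0 := by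
    rintro (_ | _) x ⟨hx, hx0⟩ a b hab
    · exact hab x ⟨hx, hx0⟩
    · rw [← norm_le_zero_iff]
      refine le_of_forall_pos_le_add fun ε hε => ?_
      have hN : 0 ≤ norm2 φ (b * a) := norm2_nonneg _ _
      obtain ⟨c, hc, hxc⟩ := hx (ε / 2 / (norm2 φ (b * a) + 1)) (by positivity)
      rw [lt_div_iff₀ (by positivity)] at hxc
      have h0 := hab _ (sub_algebraMap_mem_centred hφ.map_one (S := C) hc)
      have hφc : ‖φ c‖ ≤ norm2 φ (x - c) := by
        have := hφ.norm_map_le (x - c)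
        rwa [map_sub, hx0, zero_sub, norm_neg] at this
      have e : φ (a * x * b) = φ (b * a * (x - c + algebraMap ℂ M (φ c))) := by
        rw [← sub_eq_zero, mul_assoc b a, hφ.tracial b, ← map_sub, ← h0]
        congr 1
        noncomm_ring
      rw [e, zero_add]
      refine (hφ.norm_map_mul_le _ _).trans ?_
      have h1 := hφ.norm2_add_le (x - c) (algebraMap ℂ M (φ c))
      rw [Algebra.algebraMap_eq_smul_one, hφ.norm2_smul, hφ.norm2_one, mul_one,
        ← Algebra.algebraMap_eq_smul_one] at h1
      nlinarith [norm2_nonneg φ (x - c)]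
  -- Letters are replaced one after the other from the left; `z` is the part already moved into `C`
  -- and `D`.
  have key : ∀ i j y, AltWord (fun b => centred φ (pair (hφ.l2Closure C) D b)) i j y →
      ∀ z, (z = 1 ∨ ∃ a b, AltWord X a b z ∧ b ≠ i) → φ (z * y) = 0 := by
    have ext : ∀ i, ∀ c ∈ X i, ∀ z, (z = 1 ∨ ∃ a b, AltWord X a b z ∧ b ≠ i) →
        ∃ a, AltWord X a i (z * c) := by
      rintro i c hc z (rfl | ⟨a, b, hz, hb⟩)
      · exact ⟨i, by rw [one_mul]; exact .single hc⟩
      · exact ⟨a, hz.append hb (.single hc)⟩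
    intro i j y hy
    induction hy with
    | @single i x hx =>
      intro z hz
      rw [← mul_one (z * x)]
      refine approx i x hx z 1 fun c hc => ?_
      obtain ⟨a, ha⟩ := ext i c hc z hz
      rw [mul_one]
      exact h _ _ _ ha
    | @cons i j k x y hx hij hy ih =>
      intro z hz
      rw [← mul_assoc]
      refine approx i x hx z y fun c hc => ?_
      obtain ⟨a, ha⟩ := ext i c hc z hz
      exact ih _ (Or.inr ⟨a, i, ha, hij⟩)
  intro i j y hy
  simpa using key i j y hy 1 (Or.inl rfl)

end IsBoundedTrace

end L2

/-! ### The tracial state on matrices -/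

section MatrixTrace

variable {A : Type*} [CStarAlgebra A] {n : ℕ} {τ : A →ₗ[ℂ] ℂ}

/-- In the order of the C*-algebra y*a*ay ≤ ‖a*a‖ y*y, and the difference, being of the form b*b,
has nonnegative trace. -/
theorem IsTracialState.re_conj_le (hτ : IsTracialState τ) (a y : A) :
    (τ (star (a * y) * (a * y))).re ≤ ‖a‖ ^ 2 * (τ (star y * y)).re := by
  let := CStarAlgebra.spectralOrder A
  have := CStarAlgebra.spectralOrderedRing A
  have h : star y * (star a * a) * y ≤ ‖star a * a‖ • (star y * y) :=
    CStarAlgebra.star_left_conjugate_le_norm_smul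
  have h0 : 0 ≤ ‖star a * a‖ • (star y * y) - star y * (star a * a) * y := sub_nonneg.2 h
  obtain ⟨b, hb⟩ := CStarAlgebra.nonneg_iff_eq_star_mul_self.1 h0
  have := (Complex.nonneg_iff.1 (hτ.nonneg b)).1
  rw [← hb, map_sub, Complex.sub_re, sub_nonneg, CStarRing.norm_star_mul_self,
    ← Complex.coe_smul, map_smul, smul_eq_mul, Complex.re_ofReal_mul] at this
  rwa [star_mul, mul_assoc, ← mul_assoc (star a), ← mul_assoc, sq]

theorem IsTracialState.isBoundedTrace (hτ : IsTracialState τ) : IsBoundedTrace τ :=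
  ⟨hτ.map_one, hτ.nonneg, hτ.tracial, fun a => ⟨‖a‖ ^ 2, by positivity, hτ.re_conj_le a⟩⟩

theorem IsTracialState.norm2_le_norm (hτ : IsTracialState τ) (a : A) : norm2 τ a ≤ ‖a‖ := by
  have := hτ.re_conj_le a 1
  simp only [mul_one, star_one, hτ.map_one, Complex.one_re] at this
  rw [norm2, ← Real.sqrt_sq (norm_nonneg a)]
  exact Real.sqrt_le_sqrt this

theorem normTrace_star_mul_self (τ : A →ₗ[ℂ] ℂ) (x : Matrix (Fin n) (Fin n) A) :
    normTrace τ (star x * x) = (n : ℂ)⁻¹ * ∑ i, ∑ j, τ (star (x i j) * x i j) := by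
  rw [normTrace_apply, Finset.sum_comm]
  simp [Matrix.mul_apply, Matrix.star_apply]

theorem IsTracialState.re_normTrace (hτ : IsTracialState τ) (x : Matrix (Fin n) (Fin n) A) :
    (normTrace τ (star x * x)).re = (n : ℝ)⁻¹ * ∑ i, ∑ j, norm2 τ (x i j) ^ 2 := by
  rw [normTrace_star_mul_self, ← Complex.ofReal_natCast, ← Complex.ofReal_inv,
    Complex.re_ofReal_mul]
  simp [hτ.isBoundedTrace.norm2_sq]

theorem IsTracialState.isBoundedTrace_normTrace [NeZero n] (hτ : IsTracialState τ) :
    IsBoundedTrace (normTrace τ : Matrix (Fin n) (Fin n) A →ₗ[ℂ] ℂ) where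
  map_one := normTrace_one hτ.map_one
  tracial := normTrace_mul_comm hτ.tracial
  nonneg x := by
    rw [normTrace_star_mul_self]
    refine mul_nonneg ?_ (Finset.sum_nonneg fun i _ => Finset.sum_nonneg fun j _ => hτ.nonneg _)
    rw [← Complex.ofReal_natCast, ← Complex.ofReal_inv]
    exact_mod_cast inv_nonneg.2 (Nat.cast_nonneg n)
  bounded a := by
    have hb := hτ.isBoundedTrace
    refine ⟨n * ∑ i, ∑ k, ‖a i k‖ ^ 2, by positivity, fun y => ?_⟩
    rw [hτ.re_normTrace, hτ.re_normTrace, mul_left_comm]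
    refine mul_le_mul_of_nonneg_left ?_ (by positivity)
    have hentry : ∀ i j, norm2 τ ((a * y) i j) ^ 2 ≤
        n * ∑ k, ‖a i k‖ ^ 2 * norm2 τ (y k j) ^ 2 := by
      intro i j
      have h1 : norm2 τ ((a * y) i j) ≤ ∑ k, ‖a i k‖ * norm2 τ (y k j) := by
        rw [Matrix.mul_apply]
        refine (Finset.le_sum_of_subadditive (norm2 τ) (norm2_zero τ).le hb.norm2_add_le
          _ _).trans (Finset.sum_le_sum fun k _ => ?_)
        have := Real.sqrt_le_sqrt (hτ.re_conj_le (a i k) (y k j))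
        rwa [Real.sqrt_mul (by positivity), Real.sqrt_sq (norm_nonneg _)] at this
      calc norm2 τ ((a * y) i j) ^ 2 ≤ (∑ k, ‖a i k‖ * norm2 τ (y k j)) ^ 2 :=
            pow_le_pow_left₀ (norm2_nonneg _ _) h1 2
        _ ≤ n * ∑ k, (‖a i k‖ * norm2 τ (y k j)) ^ 2 := by
            simpa using sq_sum_le_card_mul_sum_sq (s := Finset.univ)
              (f := fun k => ‖a i k‖ * norm2 τ (y k j))
        _ = _ := by simp only [mul_pow]
    calc ∑ i, ∑ j, norm2 τ ((a * y) i j) ^ 2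
        ≤ ∑ i, ∑ j, n * ∑ k, ‖a i k‖ ^ 2 * norm2 τ (y k j) ^ 2 :=
          Finset.sum_le_sum fun i _ => Finset.sum_le_sum fun j _ => hentry i j
      _ = n * ∑ i, ∑ k, ‖a i k‖ ^ 2 * ∑ j, norm2 τ (y k j) ^ 2 := by
          simp only [Finset.mul_sum]
          exact Finset.sum_congr rfl fun i _ => Finset.sum_comm
      _ ≤ n * ∑ i, ∑ k, ‖a i k‖ ^ 2 * ∑ k, ∑ j, norm2 τ (y k j) ^ 2 := by
          refine mul_le_mul_of_nonneg_left (Finset.sum_le_sum fun i _ => Finset.sum_le_sum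
            fun k _ => mul_le_mul_of_nonneg_left ?_ (by positivity)) (by positivity)
          exact Finset.single_le_sum (f := fun k => ∑ j, norm2 τ (y k j) ^ 2)
            (fun k _ => by positivity) (Finset.mem_univ k)
      _ = _ := by simp only [Finset.sum_mul, mul_assoc]

theorem IsTracialState.norm2_normTrace_le [NeZero n] (hτ : IsTracialState τ)
    (x : Matrix (Fin n) (Fin n) A) {c : ℝ} (hc : 0 ≤ c) (h : ∀ i j, norm2 τ (x i j) ≤ c) :
    norm2 (normTrace τ) x ≤ √n * c := by
  have hn : (0 : ℝ) < n := Nat.cast_pos.2 (NeZero.pos n)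
  refine Real.sqrt_le_iff.2 ⟨by positivity, ?_⟩
  rw [hτ.re_normTrace, mul_pow, Real.sq_sqrt hn.le, inv_mul_le_iff₀ hn]
  calc ∑ i, ∑ j, norm2 τ (x i j) ^ 2 ≤ ∑ _i : Fin n, ∑ _j : Fin n, c ^ 2 :=
        Finset.sum_le_sum fun i _ => Finset.sum_le_sum fun j _ =>
          pow_le_pow_left₀ (norm2_nonneg _ _) (h i j) 2
    _ = _ := by simp

end MatrixTrace

/-! ### Second order calculus with free increments -/

section FreeMoments

variable {ι M : Type*} [Ring M] [Algebra ℂ M] {φ : M →ₗ[ℂ] ℂ} {S : ι → Subalgebra ℂ M}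

theorem FreeFamily.map_mul (h1 : φ 1 = 1) (hS : FreeFamily φ S) {i j : ι} (hij : i ≠ j) {a b : M}
    (ha : a ∈ S i) (hb : b ∈ S j) : φ (a * b) = φ a * φ b := by
  have := hS _ _ _ (.cons (sub_algebraMap_mem_centred h1 ha) hij
    (.single (sub_algebraMap_mem_centred h1 hb)))
  simp only [Algebra.algebraMap_eq_smul_one, sub_mul, mul_sub, smul_mul_assoc, mul_smul_comm,
    one_mul, mul_one, map_sub, map_smul, smul_eq_mul, h1] at this
  linear_combination this

/-- Centring `a` and `a'` leaves only the term in which both are replaced by their expectations,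
since `b` and `b'` are already centred. -/
theorem FreeFamily.map_mul_four (h1 : φ 1 = 1) (hS : FreeFamily φ S) {i j : ι} (hij : i ≠ j)
    {a a' b b' : M} (ha : a ∈ S i) (ha' : a' ∈ S i) (hb : b ∈ S j) (hb' : b' ∈ S j)
    (hb0 : φ b = 0) (hb0' : φ b' = 0) : φ (a * b * a' * b') = φ a * φ a' * φ (b * b') := by
  have e1 := hS _ _ _ (.cons (sub_algebraMap_mem_centred h1 ha) hij (.cons ⟨hb, hb0⟩ hij.symm
    (.cons (sub_algebraMap_mem_centred h1 ha') hij (.single ⟨hb', hb0'⟩))))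
  have e2 := hS _ _ _ (.cons ⟨hb, hb0⟩ hij.symm
    (.cons (sub_algebraMap_mem_centred h1 ha') hij (.single ⟨hb', hb0'⟩)))
  have e3 := hS.map_mul h1 hij ha (mul_mem hb hb')
  simp only [Algebra.algebraMap_eq_smul_one, sub_mul, mul_sub, smul_mul_assoc, mul_smul_comm,
    one_mul, map_sub, map_smul, smul_eq_mul] at e1 e2
  rw [show a * b * a' * b' = a * (b * (a' * b')) by simp only [mul_assoc]]
  linear_combination e1 + φ a * e2 + φ a' * e3

end FreeMoments

/-! ### Moments of order two and four of matrices with free entries -/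

section MatrixMoments

variable {A : Type*} [Ring A] [Algebra ℂ A] {n : ℕ} {τ : A →ₗ[ℂ] ℂ} {S : Bool → Subalgebra ℂ A}

theorem normTrace_mul_of_free (h1 : τ 1 = 1) (hS : FreeFamily τ S)
    {a d : Matrix (Fin n) (Fin n) A} (ha : a ∈ (S true).matrix) (hd : d ∈ (S false).matrix) :
    normTrace τ (a * d) = (n : ℂ)⁻¹ * (expect τ a * expect τ d).trace := by
  rw [normTrace_apply]
  congr 1
  refine Finset.sum_congr rfl fun i _ => ?_
  simp only [Matrix.mul_apply, Matrix.diag_apply, map_sum, expect_apply]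
  exact Finset.sum_congr rfl fun j _ => hS.map_mul h1 (by simp) (ha i j) (hd j i)

theorem normTrace_mul_centred_of_free (h1 : τ 1 = 1) (hS : FreeFamily τ S)
    {a d : Matrix (Fin n) (Fin n) A} (ha : a ∈ (S true).matrix) (hd : d ∈ (S false).matrix)
    (hd0 : expect τ d = 0) : normTrace τ (a * d) = 0 := by
  rw [normTrace_mul_of_free h1 hS ha hd, hd0, mul_zero, Matrix.trace_zero, mul_zero]

theorem normTrace_mul_four_of_free (h1 : τ 1 = 1) (hS : FreeFamily τ S)
    {a d : Matrix (Fin n) (Fin n) A} (ha : a ∈ (S true).matrix) (hd : d ∈ (S false).matrix)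
    (hd0 : expect τ d = 0) :
    normTrace τ (a * d * a * d) =
      (n : ℂ)⁻¹ * ∑ i, ∑ l, ∑ k, ∑ j, τ (a i j) * τ (a k l) * τ (d j k * d l i) := by
  rw [normTrace_apply]
  congr 1
  refine Finset.sum_congr rfl fun i _ => ?_
  simp only [Matrix.mul_apply, Finset.sum_mul, map_sum]
  exact Finset.sum_congr rfl fun l _ => Finset.sum_congr rfl fun k _ =>
    Finset.sum_congr rfl fun j _ => hS.map_mul_four h1 (by simp) (ha i j) (ha k l) (hd j k)
      (hd l i) (congrFun (congrFun hd0 j) k) (congrFun (congrFun hd0 l) i)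

variable {w : Matrix (Fin n) (Fin n) A} {h : ℂ}

theorem IsSemicircularMatrix.map_entry (hw : IsSemicircularMatrix τ w h) (i j : Fin n) :
    τ (w i j) = 0 := by
  simpa [entryProd, semicircularMoment] using hw [(i, j)]

theorem IsSemicircularMatrix.map_entry_mul (hw : IsSemicircularMatrix τ w h) (i j k l : Fin n) :
    τ (w i j * w k l) = matrixCov h (i, j) (k, l) := by
  simpa [entryProd, semicircularMoment] using hw [(i, j), (k, l)]

/-- Four letters have two non-crossing pairings; the crossing one, `p` with `r` and `q` with `s`, is
absent. -/
theorem IsSemicircularMatrix.map_entry_mul_four (hw : IsSemicircularMatrix τ w h)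
    (p q r s : Fin n × Fin n) :
    τ (w p.1 p.2 * w q.1 q.2 * (w r.1 r.2 * w s.1 s.2)) =
      matrixCov h p q * matrixCov h r s + matrixCov h p s * matrixCov h q r := by
  have := hw [p, q, r, s]
  simp only [semicircularMoment, entryProd, List.length_cons, List.length_nil,
    Fin.sum_univ_succ] at this
  simpa [semicircularMoment, mul_assoc] using this

theorem IsSemicircularMatrix.expect_eq_zero (hw : IsSemicircularMatrix τ w h) :
    expect τ w = 0 := by
  ext i j; exact hw.map_entry i j

theorem IsSemicircularMatrix.expect_mul_self (hw : IsSemicircularMatrix τ w h) :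
    expect τ (w * w) = ((n : ℂ) * h) • 1 := by
  ext i j
  by_cases hij : i = j <;>
    simp [expect_apply, Matrix.mul_apply, hw.map_entry_mul, matrixCov, hij]

/-- The covariance of the entries of `w² / n - h`. -/
theorem IsSemicircularMatrix.map_sq_entry_mul [NeZero n] (h1 : τ 1 = 1)
    (hw : IsSemicircularMatrix τ w h)
    {d : Matrix (Fin n) (Fin n) A} (hd : d = (n : ℂ)⁻¹ • (w * w) - h • 1) (j k l i : Fin n) :
    τ (d j k * d l i) = if j = i ∧ k = l then h ^ 2 / n else 0 := by
  have hn : (n : ℂ) ≠ 0 := by simp [NeZero.ne n]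
  have hww : ∀ a b, τ ((w * w) a b) = ((n : ℂ) * h) * (1 : Matrix (Fin n) (Fin n) ℂ) a b :=
    fun a b => congrFun (congrFun hw.expect_mul_self a) b
  -- Pairing inside each square gives the product of the means; the nested pairing gives the
  -- covariance.
  have hfour : τ ((w * w) j k * (w * w) l i) =
      n ^ 2 * h ^ 2 * (1 : Matrix (Fin n) (Fin n) ℂ) j k * (1 : Matrix (Fin n) (Fin n) ℂ) l i +
        if j = i ∧ k = l then n * h ^ 2 else 0 := by
    simp only [Matrix.mul_apply, Finset.sum_mul_sum, map_sum]
    have e : ∀ a c, τ (w j a * w a k * (w l c * w c i)) =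
        (h * (1 : Matrix (Fin n) (Fin n) ℂ) j k) * (h * (1 : Matrix (Fin n) (Fin n) ℂ) l i) +
          if a = c then (if j = i ∧ k = l then h ^ 2 else 0) else 0 := by
      intro a c
      rw [hw.map_entry_mul_four (j, a) (a, k) (l, c) (c, i)]
      simp only [matrixCov, Matrix.one_apply]
      by_cases h1 : j = k <;> by_cases h2 : l = i <;> by_cases h3 : a = c <;>
        by_cases h4 : j = i <;> by_cases h5 : k = l <;>
        simp +contextual [h1, h2, h3, h4, h5, sq]
    simp only [e, Finset.sum_add_distrib, Finset.sum_const, Finset.card_univ, Fintype.card_fin,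
      nsmul_eq_mul, Finset.sum_ite_eq, Finset.mem_univ, if_true]
    split_ifs <;> ring
  have hone : ∀ a b, τ ((1 : Matrix (Fin n) (Fin n) A) a b) =
      (1 : Matrix (Fin n) (Fin n) ℂ) a b := fun a b => congrFun (congrFun (expect_one h1) a) b
  have hmul : ∀ a b (x : A), (1 : Matrix (Fin n) (Fin n) A) a b * x =
      (1 : Matrix (Fin n) (Fin n) ℂ) a b • x := fun a b x => by
    by_cases hab : a = b <;> simp [Matrix.one_apply, hab]
  have hmul' : ∀ a b (x : A), x * (1 : Matrix (Fin n) (Fin n) A) a b =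
      (1 : Matrix (Fin n) (Fin n) ℂ) a b • x := fun a b x => by
    by_cases hab : a = b <;> simp [Matrix.one_apply, hab]
  subst hd
  simp only [Matrix.sub_apply, Matrix.smul_apply, mul_sub, sub_mul, smul_mul_assoc,
    mul_smul_comm, map_sub, map_smul, smul_eq_mul, hfour, hmul, hmul', hww, hone]
  split_ifs <;> field_simp <;> ring

end MatrixMoments

namespace IsBoundedTrace

variable {M : Type*} [Ring M] [StarRing M] [Algebra ℂ M] [StarModule ℂ M] {φ : M →ₗ[ℂ] ℂ}

theorem norm2_sum_sq_le (hφ : IsBoundedTrace φ) (f : ℕ → M) (k : ℕ) :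
    norm2 φ (∑ j ∈ Finset.range k, f j) ^ 2 ≤ k * ∑ j ∈ Finset.range k, norm2 φ (f j) ^ 2 := by
  have h3 : norm2 φ (∑ j ∈ Finset.range k, f j) ≤ ∑ j ∈ Finset.range k, norm2 φ (f j) :=
    Finset.le_sum_of_subadditive _ (norm2_zero _).le hφ.norm2_add_le _ _
  refine (pow_le_pow_left₀ (norm2_nonneg _ _) h3 2).trans ?_
  simpa using sq_sum_le_card_mul_sum_sq (s := Finset.range k) (f := fun j => norm2 φ (f j))

theorem norm2_add_sub_sq_le (hφ : IsBoundedTrace φ) (x y z : M) :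
    norm2 φ (x + y - z) ^ 2 ≤ 3 * (norm2 φ x ^ 2 + norm2 φ y ^ 2 + norm2 φ z ^ 2) := by
  have h1 := (hφ.norm2_sub_le (x + y) z).trans (add_le_add_left (hφ.norm2_add_le x y) _)
  have h2 := pow_le_pow_left₀ (norm2_nonneg φ _) h1 2
  nlinarith [sq_nonneg (norm2 φ x - norm2 φ y), sq_nonneg (norm2 φ x - norm2 φ z),
    sq_nonneg (norm2 φ y - norm2 φ z)]

end IsBoundedTrace

/-! ### The Euler scheme -/

section Euler

variable {A : Type*} [CStarAlgebra A] {n : ℕ} {τ : A →ₗ[ℂ] ℂ}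
  {F : ℝ → StarSubalgebra ℂ A} {W U : ℝ → Matrix (Fin n) (Fin n) A}

/-- The increment of the noise over the `k`-th interval of the grid of mesh `h`. -/
def gridNoise (W : ℝ → Matrix (Fin n) (Fin n) A) (h : ℝ) (k : ℕ) : Matrix (Fin n) (Fin n) A :=
  W ((k + 1 : ℕ) * h) - W (k * h)

/-- The Euler scheme of mesh `h` for `dU = (i / √n) dW U - (1/2) U dt`, `U 0 = 1`. -/
noncomputable def euler (W : ℝ → Matrix (Fin n) (Fin n) A) (h : ℝ) :
    ℕ → Matrix (Fin n) (Fin n) A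
  | 0 => 1
  | k + 1 => euler W h k + (Complex.I / (Real.sqrt n : ℂ)) • (gridNoise W h k * euler W h k) -
      ((h / 2 : ℝ) : ℂ) • euler W h k

/-- The matrices with entries in an involutive subalgebra. -/
abbrev overAlg (n : ℕ) (S : StarSubalgebra ℂ A) : Subalgebra ℂ (Matrix (Fin n) (Fin n) A) :=
  S.toSubalgebra.matrix

theorem star_mem_overAlg {S : StarSubalgebra ℂ A} {x : Matrix (Fin n) (Fin n) A}
    (hx : x ∈ overAlg n S) : star x ∈ overAlg n S := fun i j => star_mem (s := S) (hx j i)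

theorem overAlg_mono {S T : StarSubalgebra ℂ A} (h : S ≤ T) : overAlg n S ≤ overAlg n T :=
  fun _ hx i j => h (hx i j)

section Grid

variable {h : ℝ}

theorem grid_le (hh : 0 ≤ h) {j k : ℕ} (hjk : j ≤ k) : (j * h : ℝ) ≤ k * h := by gcongr

theorem grid_overAlg_mono (hF : ∀ s t, 0 ≤ s → s ≤ t → F s ≤ F t) (hh : 0 ≤ h) {j k : ℕ}
    (hjk : j ≤ k) : overAlg n (F (j * h)) ≤ overAlg n (F (k * h)) :=
  overAlg_mono (hF _ _ (by positivity) (grid_le hh hjk))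

theorem IsMatrixFreeBM.gridNoise_mem (hF : ∀ s t, 0 ≤ s → s ≤ t → F s ≤ F t)
    (hW : IsMatrixFreeBM τ F W) (hh : 0 ≤ h) (k : ℕ) :
    gridNoise W h k ∈ overAlg n (F ((k + 1 : ℕ) * h)) :=
  sub_mem (fun i j => hW.adapted _ (by positivity) i j)
    (grid_overAlg_mono hF hh k.le_succ fun i j => hW.adapted _ (by positivity) i j)

theorem IsMatrixFreeBM.star_gridNoise (hW : IsMatrixFreeBM τ F W) (hh : 0 ≤ h) (k : ℕ) :
    star (gridNoise W h k) = gridNoise W h k := by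
  have h1 : ∀ k : ℕ, star (W (k * h)) = W (k * h) := fun k => hW.selfAdjoint _ (by positivity)
  rw [gridNoise, star_sub, h1, h1]

theorem IsMatrixFreeBM.gridNoise_semicircular (hW : IsMatrixFreeBM τ F W) (hh : 0 ≤ h) (k : ℕ) :
    IsSemicircularMatrix τ (gridNoise W h k) h := by
  have := hW.isSemicircularMatrix (s := k * h) (t := (k + 1 : ℕ) * h) (by positivity)
    (grid_le hh k.le_succ)
  have e : ((k + 1 : ℕ) : ℝ) * h - k * h = h := by push_cast; ring
  rw [e] at this
  exact this

theorem IsMatrixFreeBM.gridNoise_free (hW : IsMatrixFreeBM τ F W) (hh : 0 ≤ h) (k : ℕ) :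
    FreeFamily τ (pair (F (k * h)).toSubalgebra (entryAlg (gridNoise W h k)).toSubalgebra) :=
  (hW.free _ _ (by positivity) (grid_le hh k.le_succ)).freeFamily

theorem IsMatrixFreeBM.normTrace_mul_gridNoise (hτ : IsTracialState τ) (hW : IsMatrixFreeBM τ F W)
    (hh : 0 ≤ h) {k : ℕ} {x : Matrix (Fin n) (Fin n) A} (hx : x ∈ overAlg n (F (k * h))) :
    normTrace τ (x * gridNoise W h k) = 0 :=
  normTrace_mul_centred_of_free hτ.map_one (hW.gridNoise_free hh k) hx (mem_matrix_entryAlg _)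
    (hW.gridNoise_semicircular hh k).expect_eq_zero

/-- By traciality this is the trace of xx*w², and freeness replaces w² by its expectation, the
scalar matrix nh. -/
theorem IsMatrixFreeBM.norm2_gridNoise_mul [NeZero n] (hτ : IsTracialState τ)
    (hW : IsMatrixFreeBM τ F W) (hh : 0 ≤ h) {k : ℕ} {x : Matrix (Fin n) (Fin n) A}
    (hx : x ∈ overAlg n (F (k * h))) :
    norm2 (normTrace τ) (gridNoise W h k * x) ^ 2 = n * h * norm2 (normTrace τ) x ^ 2 := by
  have hb : IsBoundedTrace (normTrace τ : Matrix (Fin n) (Fin n) A →ₗ[ℂ] ℂ) :=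
    hτ.isBoundedTrace_normTrace
  have hmem := mem_matrix_entryAlg (gridNoise W h k)
  have e := normTrace_mul_of_free hτ.map_one (hW.gridNoise_free hh k)
    (mul_mem hx (star_mem_overAlg hx)) (mul_mem hmem hmem)
  rw [(hW.gridNoise_semicircular hh k).expect_mul_self, mul_smul_comm, mul_one,
    Matrix.trace_smul, smul_eq_mul, mul_left_comm, ← normTrace_eq_trace_expect] at e
  rw [hb.norm2_sq, star_mul, hW.star_gridNoise hh]
  have e2 : normTrace τ (star x * gridNoise W h k * (gridNoise W h k * x)) =
      ((n * h : ℝ) : ℂ) * normTrace τ (star x * x) := by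
    have e3 : star x * gridNoise W h k * (gridNoise W h k * x) =
        star x * (gridNoise W h k * gridNoise W h k) * x := by simp only [mul_assoc]
    rw [e3, hb.tracial, ← mul_assoc, e, hb.tracial x (star x)]
    push_cast
    rfl
  rw [e2, Complex.re_ofReal_mul, hb.norm2_sq]

/-- The Itô isometry on a grid. -/
theorem IsMatrixFreeBM.norm2_sum_gridNoise_mul [NeZero n] (hτ : IsTracialState τ)
    (hF : ∀ s t, 0 ≤ s → s ≤ t → F s ≤ F t) (hW : IsMatrixFreeBM τ F W) (hh : 0 ≤ h)
    {x : ℕ → Matrix (Fin n) (Fin n) A} (K : ℕ) (hx : ∀ k < K, x k ∈ overAlg n (F (k * h))) :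
    norm2 (normTrace τ) (∑ k ∈ Finset.range K, gridNoise W h k * x k) ^ 2 =
      n * h * ∑ k ∈ Finset.range K, norm2 (normTrace τ) (x k) ^ 2 := by
  have hb : IsBoundedTrace (normTrace τ : Matrix (Fin n) (Fin n) A →ₗ[ℂ] ℂ) :=
    hτ.isBoundedTrace_normTrace
  induction K with
  | zero => simp [norm2_zero]
  | succ K ih =>
    rw [Finset.sum_range_succ, Finset.sum_range_succ, hb.norm2_add_sq, ih fun k hk => hx k (by omega),
      hW.norm2_gridNoise_mul hτ hh (hx K (by omega)), mul_add]
    have hS : ∑ k ∈ Finset.range K, gridNoise W h k * x k ∈ overAlg n (F (K * h)) :=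
      Subalgebra.sum_mem _ fun k hk => by
        have hk := Finset.mem_range.1 hk
        exact mul_mem (grid_overAlg_mono hF hh hk (hW.gridNoise_mem hF hh k))
          (grid_overAlg_mono hF hh hk.le (hx k (by omega)))
    -- The cross term is the trace of an element of the past times the last increment, which is
    -- centred and free from that past.
    rw [← mul_assoc, hb.tracial, ← mul_assoc]
    exact hW.normTrace_mul_gridNoise hτ hh (mul_mem (hx K (by omega)) (star_mem_overAlg hS))

theorem IsMatrixFreeBM.euler_mem (hF : ∀ s t, 0 ≤ s → s ≤ t → F s ≤ F t)
    (hW : IsMatrixFreeBM τ F W) (hh : 0 ≤ h) (k : ℕ) :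
    euler W h k ∈ overAlg n (F (k * h)) := by
  induction k with
  | zero => exact one_mem _
  | succ k ih =>
    have ih' := grid_overAlg_mono hF hh k.le_succ ih
    exact sub_mem (add_mem ih' (Subalgebra.smul_mem _
      (mul_mem (hW.gridNoise_mem hF hh k) ih') _)) (Subalgebra.smul_mem _ ih' _)

theorem euler_mem_adjoin (W : ℝ → Matrix (Fin n) (Fin n) A) (h : ℝ) {k K : ℕ} (hk : k ≤ K) :
    euler W h k ∈ Algebra.adjoin ℂ {x | ∃ j : ℕ, j ≤ K ∧ x = W (j * h)} := by
  induction k with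
  | zero => exact one_mem _
  | succ k ih =>
    have ih' := ih (by omega)
    have hmem : ∀ j : ℕ, j ≤ K → W (j * h) ∈ Algebra.adjoin ℂ {x | ∃ j : ℕ, j ≤ K ∧ x = W (j * h)} :=
      fun j hj => Algebra.subset_adjoin ⟨j, hj, rfl⟩
    exact sub_mem (add_mem ih' (Subalgebra.smul_mem _ (mul_mem (sub_mem (hmem _ hk)
      (hmem k (by omega))) ih') _)) (Subalgebra.smul_mem _ ih' _)

theorem euler_eq_sum (W : ℝ → Matrix (Fin n) (Fin n) A) (h : ℝ) (k : ℕ) :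
    euler W h k = 1 + (Complex.I / (Real.sqrt n : ℂ)) •
      ∑ j ∈ Finset.range k, gridNoise W h j * euler W h j -
      ((h / 2 : ℝ) : ℂ) • ∑ j ∈ Finset.range k, euler W h j := by
  induction k with
  | zero => simp [euler]
  | succ k ih =>
    rw [euler, Finset.sum_range_succ, Finset.sum_range_succ, smul_add, smul_add]
    nth_rewrite 1 [ih]
    abel

end Grid

theorem discrete_gronwall {e : ℕ → ℝ} {a b : ℝ} (hb : 0 ≤ b) {K : ℕ}
    (he : ∀ k ≤ K, e k ≤ a + b * ∑ j ∈ Finset.range k, e j) {k : ℕ} (hk : k ≤ K) :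
    e k ≤ a * (1 + b) ^ k := by
  -- The induction runs on the majorant, which has an exact one-step recursion.
  suffices h : ∀ k ≤ K, a + b * ∑ j ∈ Finset.range k, e j ≤ a * (1 + b) ^ k from
    (he k hk).trans (h k hk)
  intro k
  induction k with
  | zero => simp
  | succ k ih =>
    intro hk
    have h1 := ih (by omega)
    have h2 := (he k (by omega)).trans h1
    rw [Finset.sum_range_succ, pow_succ]
    nlinarith

theorem norm_I_div_sqrt [NeZero n] : ‖Complex.I / (Real.sqrt n : ℂ)‖ ^ 2 * n = 1 := by
  have hn : (0 : ℝ) < n := Nat.cast_pos.2 (NeZero.pos n)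
  rw [norm_div, Complex.norm_I, Complex.norm_real, Real.norm_eq_abs, div_pow, sq_abs,
    Real.sq_sqrt hn.le]
  field_simp

/-- Stability of the Euler scheme: a process that satisfies the scheme up to an error `ε` is close
to it. -/
theorem IsMatrixFreeBM.norm2_sub_euler_le [NeZero n] (hτ : IsTracialState τ)
    (hF : ∀ s t, 0 ≤ s → s ≤ t → F s ≤ F t) (hW : IsMatrixFreeBM τ F W) {h T ε : ℝ} (hh : 0 ≤ h)
    {K : ℕ} (hK : K * h ≤ T) {x : ℕ → Matrix (Fin n) (Fin n) A}
    (hx : ∀ k ≤ K, x k ∈ overAlg n (F (k * h)))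
    (hε : ∀ k ≤ K, norm2 (normTrace τ) (x k - (1 + (Complex.I / (Real.sqrt n : ℂ)) •
      ∑ j ∈ Finset.range k, gridNoise W h j * x j -
      ((h / 2 : ℝ) : ℂ) • ∑ j ∈ Finset.range k, x j)) ≤ ε) :
    norm2 (normTrace τ) (x K - euler W h K) ^ 2 ≤
      3 * ε ^ 2 * Real.exp (3 * (1 + T) * T) := by
  have hb : IsBoundedTrace (normTrace τ : Matrix (Fin n) (Fin n) A →ₗ[ℂ] ℂ) :=
    hτ.isBoundedTrace_normTrace
  have hT : 0 ≤ T := le_trans (by positivity) hK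
  set e : ℕ → Matrix (Fin n) (Fin n) A := fun k => x k - euler W h k with he
  set c : ℂ := Complex.I / (Real.sqrt n : ℂ) with hc
  have hrec : ∀ k ≤ K, norm2 (normTrace τ) (e k) ^ 2 ≤ 3 * ε ^ 2 +
      3 * (1 + T) * h * ∑ j ∈ Finset.range k, norm2 (normTrace τ) (e j) ^ 2 := by
    intro k hk
    have hsplit : e k = (x k - (1 + c • ∑ j ∈ Finset.range k, gridNoise W h j * x j -
        ((h / 2 : ℝ) : ℂ) • ∑ j ∈ Finset.range k, x j)) +
        c • (∑ j ∈ Finset.range k, gridNoise W h j * e j) -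
        ((h / 2 : ℝ) : ℂ) • ∑ j ∈ Finset.range k, e j := by
      simp only [he, mul_sub, Finset.sum_sub_distrib, smul_sub]
      nth_rewrite 1 [euler_eq_sum]
      abel
    have h1 : norm2 (normTrace τ) (c • ∑ j ∈ Finset.range k, gridNoise W h j * e j) ^ 2 =
        h * ∑ j ∈ Finset.range k, norm2 (normTrace τ) (e j) ^ 2 := by
      rw [hb.norm2_smul, mul_pow, hW.norm2_sum_gridNoise_mul hτ hF hh k fun j hj =>
        sub_mem (hx j (by omega)) (hW.euler_mem hF hh j), ← mul_assoc, ← mul_assoc, hc,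
        norm_I_div_sqrt, one_mul]
    have h2 : norm2 (normTrace τ) (((h / 2 : ℝ) : ℂ) • ∑ j ∈ Finset.range k, e j) ^ 2 =
        (h / 2) ^ 2 * norm2 (normTrace τ) (∑ j ∈ Finset.range k, e j) ^ 2 := by
      rw [hb.norm2_smul, Complex.norm_real, Real.norm_of_nonneg (by positivity), mul_pow]
    have h5 := hb.norm2_sum_sq_le e k
    have h6 : (k * h : ℝ) ≤ T := (grid_le hh hk).trans hK
    have h7 : 0 ≤ ∑ j ∈ Finset.range k, norm2 (normTrace τ) (e j) ^ 2 :=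
      Finset.sum_nonneg fun _ _ => sq_nonneg _
    have h8 := pow_le_pow_left₀ (norm2_nonneg _ _) (hε k hk) 2
    have h9 := hb.norm2_add_sub_sq_le (x k - (1 + c • ∑ j ∈ Finset.range k,
        gridNoise W h j * x j - ((h / 2 : ℝ) : ℂ) • ∑ j ∈ Finset.range k, x j))
        (c • (∑ j ∈ Finset.range k, gridNoise W h j * e j))
        (((h / 2 : ℝ) : ℂ) • ∑ j ∈ Finset.range k, e j)
    rw [← hsplit, h1, h2] at h9
    generalize ∑ j ∈ Finset.range k, norm2 (normTrace τ) (e j) ^ 2 = s at h5 h7 h9 ⊢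
    generalize norm2 (normTrace τ) (∑ j ∈ Finset.range k, e j) ^ 2 = v at h5 h9
    -- Cauchy-Schwarz costs a factor `k`, absorbed by `k * h ≤ T`.
    have h10 : (h / 2) ^ 2 * v ≤ T * (h * s) := by
      have h11 : 0 ≤ h * s := mul_nonneg hh h7
      calc (h / 2) ^ 2 * v ≤ (h / 2) ^ 2 * (k * s) := by gcongr
        _ = (1 / 4) * ((k * h) * (h * s)) := by ring
        _ ≤ (1 / 4) * (T * (h * s)) := by gcongr
        _ ≤ _ := by nlinarith [mul_nonneg hT h11]
    linarith
  refine (discrete_gronwall (by positivity) hrec le_rfl).trans ?_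
  gcongr
  have h1 : 1 + 3 * (1 + T) * h ≤ Real.exp (3 * (1 + T) * h) := by
    rw [add_comm]; exact Real.add_one_le_exp _
  calc (1 + 3 * (1 + T) * h) ^ K ≤ Real.exp (3 * (1 + T) * h) ^ K := by gcongr
    _ = Real.exp (3 * (1 + T) * (K * h)) := by rw [← Real.exp_nat_mul]; ring_nf
    _ ≤ _ := by gcongr

end Euler

/-! ### L² convergence of the Euler scheme -/

section Convergence

variable {A : Type*} [CStarAlgebra A] {n : ℕ} {τ : A →ₗ[ℂ] ℂ}
  {F : ℝ → StarSubalgebra ℂ A} {W U : ℝ → Matrix (Fin n) (Fin n) A}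

/-- Refining the grid by a factor `m`. -/
theorem sum_gridNoise_refine (W : ℝ → Matrix (Fin n) (Fin n) A) (h : ℝ) {m : ℕ} (hm : 0 < m)
    (X : ℕ → Matrix (Fin n) (Fin n) A) (k : ℕ) :
    ∑ j ∈ Finset.range k, gridNoise W h j * X j =
      ∑ i ∈ Finset.range (k * m), gridNoise W (h / m) i * X (i / m) := by
  have hm' : (m : ℝ) ≠ 0 := Nat.cast_ne_zero.2 hm.ne'
  induction k with
  | zero => simp
  | succ k ih =>
    rw [Finset.sum_range_succ, ih, Nat.succ_mul, Finset.sum_range_add]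
    congr 1
    have e1 : ∀ r ∈ Finset.range m, gridNoise W (h / m) (k * m + r) * X ((k * m + r) / m) =
        (W ((k * m + (r + 1) : ℕ) * (h / m)) - W ((k * m + r : ℕ) * (h / m))) * X k := by
      intro r hr
      rw [Nat.mul_comm k m, Nat.mul_add_div hm, Nat.div_eq_of_lt (Finset.mem_range.1 hr), add_zero]
      rfl
    rw [Finset.sum_congr rfl e1, ← Finset.sum_mul,
      Finset.sum_range_sub fun r => W ((k * m + r : ℕ) * (h / m)), gridNoise]
    have e2 : ((k + 1 : ℕ) : ℝ) * h = (k * m + m : ℕ) * (h / m) := by push_cast; field_simp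
    have e3 : (k : ℝ) * h = (k * m + 0 : ℕ) * (h / m) := by rw [add_zero]; push_cast; field_simp
    rw [e2, e3]

theorem IsTracialState.norm2_sub_le_of_entries [NeZero n] (hτ : IsTracialState τ)
    {x y : Matrix (Fin n) (Fin n) A} {c : ℝ} (hc : 0 ≤ c) (h : ∀ i j, ‖x i j - y i j‖ ≤ c) :
    norm2 (normTrace τ) (x - y) ≤ √n * c :=
  hτ.norm2_normTrace_le _ hc fun i j => (hτ.norm2_le_norm _).trans (h i j)

/-- Riemann sums along a grid are close to the Itô integral of a process with small oscillation. -/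
theorem IsFreeUnitaryBM.norm2_sub_sum_gridNoise_le [NeZero n] (hτ : IsTracialState τ)
    (hU : IsFreeUnitaryBM τ F W U) {T δ ω h : ℝ} (hω : 0 < ω) (hh : 0 ≤ h) (hhδ : h < δ)
    (hosc : ∀ s t, 0 ≤ s → s ≤ t → t ≤ T → t - s < δ → ∀ i j, ‖U t i j - U s i j‖ ≤ ω)
    {k : ℕ} (hk : k * h ≤ T) {I : Matrix (Fin n) (Fin n) A}
    (hI : IsItoIntegral τ W U (k * h) I) :
    norm2 (normTrace τ) (I - ∑ j ∈ Finset.range k, gridNoise W h j * U (j * h)) ≤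
      (√n + n * √T) * ω := by
  have hb : IsBoundedTrace (normTrace τ : Matrix (Fin n) (Fin n) A →ₗ[ℂ] ℂ) :=
    hτ.isBoundedTrace_normTrace
  have hT : 0 ≤ T := le_trans (by positivity) hk
  obtain ⟨δ', hδ', hI⟩ := hI (ω ^ 2) (by positivity)
  -- The mesh `h` is only adapted to the oscillation of `U`. The Itô integral may need a finer grid,
  -- obtained by cutting each interval into `m` pieces.
  obtain ⟨m, hm⟩ := exists_nat_gt (h / δ')
  have hm0 : 0 < m := by
    rcases Nat.eq_zero_or_pos m with rfl | h0
    · exact absurd hm (not_lt.2 (by simpa using div_nonneg hh hδ'.le))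
    · exact h0
  have hmR : (0 : ℝ) < m := Nat.cast_pos.2 hm0
  have hmesh : h / m < δ' := by
    rw [div_lt_iff₀ hmR]; rw [div_lt_iff₀ hδ'] at hm; linarith
  set fine := ∑ i ∈ Finset.range (k * m), gridNoise W (h / m) i * U (i * (h / m)) with hfine
  have h1 : norm2 (normTrace τ) (I - fine) ≤ √n * ω := by
    refine hτ.norm2_normTrace_le _ hω.le fun i j => ?_
    have := hI (k * m) (fun i => i * (h / m)) (by simp) (by push_cast; field_simp)
      (fun i _ => ⟨by push_cast; have := div_nonneg hh hmR.le; nlinarith, by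
        push_cast; have : ((i : ℝ) + 1) * (h / m) - i * (h / m) = h / m := by ring
        rwa [this]⟩) i j
    rw [norm2, ← Real.sqrt_sq hω.le]
    exact Real.sqrt_le_sqrt this.le
  have hmul : ∀ i : ℕ, (i : ℝ) * (h / m) = (i / m : ℕ) * h + (i % m : ℕ) * (h / m) := by
    intro i
    have : (i : ℝ) = m * (i / m : ℕ) + (i % m : ℕ) := by exact_mod_cast (Nat.div_add_mod i m).symm
    nth_rewrite 1 [this]
    field_simp
  have hdiff : ∀ i < k * m, (((i / m : ℕ) : ℝ) * h ≤ i * (h / m)) ∧ (i * (h / m) ≤ T) ∧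
      i * (h / m) - (i / m : ℕ) * h < δ := by
    intro i hi
    have h2 : 0 ≤ h / m := div_nonneg hh hmR.le
    have h3 : ((i % m : ℕ) : ℝ) * (h / m) ≤ h := by
      have : ((i % m : ℕ) : ℝ) ≤ m := by exact_mod_cast (Nat.mod_lt i hm0).le
      calc ((i % m : ℕ) : ℝ) * (h / m) ≤ m * (h / m) := by gcongr
        _ = h := by field_simp
    have h4 : 0 ≤ ((i % m : ℕ) : ℝ) * (h / m) := by positivity
    refine ⟨by rw [hmul]; linarith, ?_, by rw [hmul]; linarith⟩
    have : (i : ℝ) ≤ k * m := by exact_mod_cast hi.le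
    calc (i : ℝ) * (h / m) ≤ (k * m) * (h / m) := by gcongr
      _ = k * h := by field_simp
      _ ≤ T := hk
  -- On the fine grid both sums use the same increments, so the Itô isometry bounds the difference
  -- by the oscillation of `U`, independently of `m`.
  have h2 : norm2 (normTrace τ) (fine - ∑ j ∈ Finset.range k, gridNoise W h j * U (j * h)) ≤
      n * √T * ω := by
    rw [sum_gridNoise_refine W h hm0, hfine, ← Finset.sum_sub_distrib]
    simp only [← mul_sub]
    have hiso := hU.noise.norm2_sum_gridNoise_mul hτ hU.filtration (div_nonneg hh hmR.le) (k * m)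
      (x := fun i => U (i * (h / m)) - U ((i / m : ℕ) * h)) (fun i hi => sub_mem
        (fun a b => hU.adapted _ (mul_nonneg (Nat.cast_nonneg _) (div_nonneg hh hmR.le)) a b)
        (fun a b => hU.filtration _ _ (by positivity) (hdiff i hi).1
          (hU.adapted _ (by positivity) a b)))
    refine le_of_sq_le_sq ?_ (by positivity)
    rw [hiso]
    have hterm : ∀ i ∈ Finset.range (k * m),
        norm2 (normTrace τ) (U (i * (h / m)) - U ((i / m : ℕ) * h)) ^ 2 ≤ n * ω ^ 2 := by
      intro i hi
      obtain ⟨ha, hb, hc⟩ := hdiff i (Finset.mem_range.1 hi)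
      have := hτ.norm2_sub_le_of_entries hω.le (hosc _ _ (by positivity) ha hb hc)
      have := pow_le_pow_left₀ (norm2_nonneg _ _) this 2
      rwa [mul_pow, Real.sq_sqrt (Nat.cast_nonneg n)] at this
    have hsum := Finset.sum_le_sum hterm
    rw [Finset.sum_const, Finset.card_range, nsmul_eq_mul] at hsum
    calc _ ≤ n * (h / m) * (((k * m : ℕ) : ℝ) * (n * ω ^ 2)) := by gcongr
      _ = n ^ 2 * (k * h) * ω ^ 2 := by push_cast; field_simp
      _ ≤ n ^ 2 * T * ω ^ 2 := by gcongr
      _ = (n * √T * ω) ^ 2 := by rw [mul_pow, mul_pow, Real.sq_sqrt hT]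
  have := hb.norm2_add_le (I - fine)
    (fine - ∑ j ∈ Finset.range k, gridNoise W h j * U (j * h))
  rw [sub_add_sub_cancel] at this
  linarith

theorem norm_integral_sub_sum_le {f : ℝ → A} {T δ ω h : ℝ} (hω : 0 ≤ ω) (hh : 0 ≤ h) (hhδ : h < δ)
    (hf : ContinuousOn f (Set.Ici 0))
    (hosc : ∀ s t, 0 ≤ s → s ≤ t → t ≤ T → t - s < δ → ‖f t - f s‖ ≤ ω) {k : ℕ}
    (hk : k * h ≤ T) :
    ‖(∫ s in (0 : ℝ)..(k * h), f s) - h • ∑ j ∈ Finset.range k, f (j * h)‖ ≤ T * ω := by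
  have hint : ∀ a b, 0 ≤ a → 0 ≤ b → IntervalIntegrable f MeasureTheory.volume a b :=
    fun a b ha hb => (hf.mono fun x hx => (le_min ha hb).trans hx.1).intervalIntegrable
  have hpos : ∀ j : ℕ, (0 : ℝ) ≤ j * h := fun j => by positivity
  have hsplit := intervalIntegral.sum_integral_adjacent_intervals (f := f)
    (μ := MeasureTheory.volume) (a := fun j : ℕ => (j : ℝ) * h) (n := k)
    fun j _ => hint _ _ (hpos j) (hpos (j + 1))
  simp only [Nat.cast_zero, zero_mul] at hsplit
  rw [← hsplit, Finset.smul_sum, ← Finset.sum_sub_distrib]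
  have hterm : ∀ j ∈ Finset.range k,
      ‖(∫ s in (j * h : ℝ)..((j + 1 : ℕ) * h), f s) - h • f (j * h)‖ ≤ ω * h := by
    intro j hj
    have hlen : ((j + 1 : ℕ) : ℝ) * h - j * h = h := by push_cast; ring
    have hle : (j * h : ℝ) ≤ (j + 1 : ℕ) * h := grid_le hh j.le_succ
    have e : (∫ s in (j * h : ℝ)..((j + 1 : ℕ) * h), f s) - h • f (j * h) =
        ∫ s in (j * h : ℝ)..((j + 1 : ℕ) * h), (f s - f (j * h)) := by
      rw [intervalIntegral.integral_sub (hint _ _ (hpos _) (hpos _)) (by simp),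
        intervalIntegral.integral_const, hlen]
    rw [e]
    have := intervalIntegral.norm_integral_le_of_norm_le_const (a := (j * h : ℝ))
      (b := (j + 1 : ℕ) * h) (f := fun s => f s - f (j * h)) (C := ω) fun s hs => by
        rw [Set.uIoc_of_le hle] at hs
        have h1 : ((j + 1 : ℕ) : ℝ) * h ≤ T :=
          (grid_le hh (Finset.mem_range.1 hj)).trans hk
        exact hosc _ _ (hpos j) hs.1.le (hs.2.trans h1) (by linarith [hs.2])
    rwa [hlen, abs_of_nonneg hh] at this
  refine (norm_sum_le_of_le _ hterm).trans ?_
  rw [Finset.sum_const, Finset.card_range, nsmul_eq_mul]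
  calc (k : ℝ) * (ω * h) = k * h * ω := by ring
    _ ≤ T * ω := by gcongr

/-- The process satisfies the Euler scheme up to a small error. -/
theorem IsFreeUnitaryBM.norm2_consistency [NeZero n] (hτ : IsTracialState τ)
    (hU : IsFreeUnitaryBM τ F W U) {T δ ω h : ℝ} (hω : 0 < ω) (hh : 0 ≤ h) (hhδ : h < δ)
    (hosc : ∀ s t, 0 ≤ s → s ≤ t → t ≤ T → t - s < δ → ∀ i j, ‖U t i j - U s i j‖ ≤ ω)
    {k : ℕ} (hk : k * h ≤ T) :
    norm2 (normTrace τ) (U (k * h) - (1 + (Complex.I / (Real.sqrt n : ℂ)) •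
      ∑ j ∈ Finset.range k, gridNoise W h j * U (j * h) -
      ((h / 2 : ℝ) : ℂ) • ∑ j ∈ Finset.range k, U (j * h))) ≤
      (√n + n * √T + √n * T) * ω := by
  have hb : IsBoundedTrace (normTrace τ : Matrix (Fin n) (Fin n) A →ₗ[ℂ] ℂ) :=
    hτ.isBoundedTrace_normTrace
  have hT : 0 ≤ T := le_trans (by positivity) hk
  obtain ⟨I, hI, hUI⟩ := hU.sde (k * h) (by positivity)
  have h1 := hU.norm2_sub_sum_gridNoise_le hτ hω hh hhδ hosc hk hI
  set J : Matrix (Fin n) (Fin n) A := Matrix.of fun i j => ∫ s in (0 : ℝ)..(k * h), U s i j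
  set S1 := ∑ j ∈ Finset.range k, gridNoise W h j * U (j * h)
  set S2 := ∑ j ∈ Finset.range k, U (j * h) with hS2
  have h2 : norm2 (normTrace τ) (J - (h : ℂ) • S2) ≤ √n * (T * ω) := by
    refine hτ.norm2_sub_le_of_entries (by positivity) fun i j => ?_
    have := norm_integral_sub_sum_le hω.le hh hhδ (hU.continuous i j)
      (fun s t h1 h2 h3 h4 => hosc s t h1 h2 h3 h4 i j) hk
    simpa [J, hS2, Matrix.sum_apply, Complex.coe_smul] using this
  have e : U (k * h) - (1 + (Complex.I / (Real.sqrt n : ℂ)) • S1 - ((h / 2 : ℝ) : ℂ) • S2) =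
      (Complex.I / (Real.sqrt n : ℂ)) • (I - S1) - (1 / 2 : ℂ) • (J - (h : ℂ) • S2) := by
    rw [hUI, smul_sub, smul_sub, smul_smul]
    have : (1 / 2 : ℂ) * h = ((h / 2 : ℝ) : ℂ) := by push_cast; ring
    rw [this]
    abel
  have hc : ‖Complex.I / (Real.sqrt n : ℂ)‖ ≤ 1 := by
    have h3 := norm_I_div_sqrt (n := n)
    have hn : (1 : ℝ) ≤ n := by exact_mod_cast NeZero.one_le
    have h4 : ‖Complex.I / (Real.sqrt n : ℂ)‖ ^ 2 ≤ 1 := by nlinarith [sq_nonneg ‖Complex.I / (Real.sqrt n : ℂ)‖]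
    exact (sq_le_one_iff₀ (norm_nonneg _)).1 h4
  rw [e]
  refine (hb.norm2_sub_le _ _).trans ?_
  rw [hb.norm2_smul, hb.norm2_smul]
  have h5 : ‖(1 / 2 : ℂ)‖ ≤ 1 := by norm_num
  have h6 := mul_le_mul hc h1 (norm2_nonneg _ _) zero_le_one
  have h7 := mul_le_mul h5 h2 (norm2_nonneg _ _) zero_le_one
  linarith

theorem exists_oscillation_le {U : ℝ → Matrix (Fin n) (Fin n) A}
    (hU : ∀ i j, ContinuousOn (fun t => U t i j) (Set.Ici 0)) (T : ℝ) {ω : ℝ} (hω : 0 < ω) :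
    ∃ δ > 0, ∀ s t, 0 ≤ s → s ≤ t → t ≤ T → t - s < δ → ∀ i j, ‖U t i j - U s i j‖ ≤ ω := by
  have huc : ∀ i j, ∃ δ > 0, ∀ s ∈ Set.Icc 0 T, ∀ t ∈ Set.Icc 0 T, dist s t < δ →
      dist (U s i j) (U t i j) < ω := fun i j =>
    Metric.uniformContinuousOn_iff.1 (isCompact_Icc.uniformContinuousOn_of_continuous
      ((hU i j).mono Set.Icc_subset_Ici_self)) ω hω
  choose δ hδ h using huc
  have hfin : ∃ δ₀ > 0, ∀ p : Fin n × Fin n, δ₀ ≤ δ p.1 p.2 := by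
    rcases isEmpty_or_nonempty (Fin n × Fin n) with he | he
    · exact ⟨1, one_pos, fun p => he.elim p⟩
    · obtain ⟨p, hp⟩ := Finite.exists_min fun p : Fin n × Fin n => δ p.1 p.2
      exact ⟨δ p.1 p.2, hδ _ _, hp⟩
  obtain ⟨δ₀, hδ₀, hle⟩ := hfin
  refine ⟨δ₀, hδ₀, fun s t hs hst ht hd i j => ?_⟩
  rw [← dist_eq_norm, dist_comm]
  refine (h i j s ⟨hs, hst.trans ht⟩ t ⟨hs.trans hst, ht⟩ ?_).le
  rw [dist_comm, Real.dist_eq, abs_of_nonneg (by linarith)]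
  exact hd.trans_le (hle (i, j))

/-- The Euler scheme converges in `L²` to the free unitary Brownian motion. -/
theorem IsFreeUnitaryBM.tendsto_euler [NeZero n] (hτ : IsTracialState τ)
    (hU : IsFreeUnitaryBM τ F W U) {T : ℝ} (hT : 0 ≤ T) :
    Filter.Tendsto (fun N : ℕ => norm2 (normTrace τ) (U T - euler W (T / N) N)) Filter.atTop
      (nhds 0) := by
  rw [Metric.tendsto_atTop]
  intro ε hε
  set C := √n + n * √T + √n * T with hC
  set E := Real.exp (3 * (1 + T) * T)
  have hC0 : 0 ≤ C := by positivity
  have hE0 : 0 < E := Real.exp_pos _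
  -- `C` is the consistency constant and `E` the Gronwall factor. This choice gives 2Cω(E + 1) ≤ ε,
  -- hence 3(Cω)²E ≤ (3/4)ε².
  set ω := ε / (2 * (C + 1) * (E + 1)) with hω
  have hω0 : 0 < ω := by positivity
  obtain ⟨δ, hδ, hosc⟩ := exists_oscillation_le hU.continuous T hω0
  obtain ⟨N₀, hN₀⟩ := exists_nat_gt (T / δ)
  refine ⟨N₀ + 1, fun N hN => ?_⟩
  have hNpos : (0 : ℝ) < N := Nat.cast_pos.2 (by omega)
  have hN₀N : (N₀ : ℝ) ≤ N := by exact_mod_cast (by omega : N₀ ≤ N)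
  have hh : 0 ≤ T / N := by positivity
  have hhδ : T / N < δ := by
    rw [div_lt_iff₀ hNpos]
    have := (div_lt_iff₀ hδ).1 hN₀
    nlinarith
  have hNT : (N : ℝ) * (T / N) = T := by field_simp
  have hmain := hU.noise.norm2_sub_euler_le hτ hU.filtration hh hNT.le
    (x := fun k => U (k * (T / N)))
    (fun k _ i j => hU.adapted _ (by positivity) i j)
    (fun k hk => hU.norm2_consistency hτ hω0 hh hhδ hosc ((grid_le hh hk).trans hNT.le))
  simp only [hNT] at hmain
  rw [Real.dist_eq, sub_zero, abs_of_nonneg (norm2_nonneg _ _)]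
  refine lt_of_pow_lt_pow_left₀ 2 hε.le (hmain.trans_lt ?_)
  have hCω : C * ω * (2 * (E + 1)) ≤ ε := by
    rw [hω]
    have : C * (ε / (2 * (C + 1) * (E + 1))) * (2 * (E + 1)) = ε * (C / (C + 1)) := by
      field_simp
    rw [this]
    exact mul_le_of_le_one_right hε.le ((div_le_one (by positivity)).2 (by linarith))
  have h1 : (C * ω * (2 * (E + 1))) ^ 2 ≤ ε ^ 2 := pow_le_pow_left₀ (by positivity) hCω 2
  have h2 : 3 * (C * ω) ^ 2 * E ≤ (C * ω * (2 * (E + 1))) ^ 2 * (3 / 4) := by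
    have : (C * ω * (2 * (E + 1))) ^ 2 * (3 / 4) = 3 * (C * ω) ^ 2 * (E + 1) ^ 2 := by ring
    rw [this]
    gcongr
    nlinarith
  nlinarith [sq_pos_of_pos hε]

end Convergence

/-! ### Unitarity -/

section Unitarity

variable {A : Type*} [CStarAlgebra A] {n : ℕ} {τ : A →ₗ[ℂ] ℂ}
  {F : ℝ → StarSubalgebra ℂ A} {W U : ℝ → Matrix (Fin n) (Fin n) A}

/-- The terms linear in the noise cancel because it is selfadjoint and its coefficient imaginary.
The drift contributes -h, which is exactly what centres w²/n. -/
theorem euler_star_mul_self_succ [NeZero n] (hW : IsMatrixFreeBM τ F W) {h : ℝ} (hh : 0 ≤ h)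
    (k : ℕ) :
    star (euler W h (k + 1)) * euler W h (k + 1) =
      ((1 + h ^ 2 / 4 : ℝ) : ℂ) • (star (euler W h k) * euler W h k) +
        star (euler W h k) * ((n : ℂ)⁻¹ • (gridNoise W h k * gridNoise W h k) - (h : ℂ) • 1) *
          euler W h k := by
  have hn : (0 : ℝ) < n := Nat.cast_pos.2 (NeZero.pos n)
  set x := euler W h k
  set w := gridNoise W h k with hw
  set c : ℂ := Complex.I / (Real.sqrt n : ℂ) with hc
  have hstarw : star w = w := hW.star_gridNoise hh k
  have hstarc : star c = -c := by
    simp [hc, neg_div]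
  have hcc : c * c = -(n : ℂ)⁻¹ := by
    have hs : ((Real.sqrt n : ℂ)) * (Real.sqrt n : ℂ) = n := by
      rw [← Complex.ofReal_mul, Real.mul_self_sqrt hn.le, Complex.ofReal_natCast]
    rw [hc, div_mul_div_comm, Complex.I_mul_I, hs, neg_div, one_div]
  have hstarh : star ((h / 2 : ℝ) : ℂ) = ((h / 2 : ℝ) : ℂ) := Complex.conj_ofReal _
  have e1 : star (euler W h (k + 1)) =
      star x - c • (star x * w) - ((h / 2 : ℝ) : ℂ) • star x := by
    rw [euler, star_sub, star_add, star_smul, star_smul, star_mul, hstarw, hstarc, hstarh,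
      neg_smul, ← sub_eq_add_neg]
  have e2 : euler W h (k + 1) = x + c • (w * x) - ((h / 2 : ℝ) : ℂ) • x := rfl
  rw [e1, e2]
  simp only [sub_mul, mul_sub, mul_add, smul_mul_assoc, mul_smul_comm, smul_sub,
    smul_smul, mul_one, mul_assoc, hcc]
  push_cast
  module

/-- The norm of the fluctuation of `x* x` over one step. -/
theorem norm2_fluctuation [NeZero n] (hτ : IsTracialState τ) (hW : IsMatrixFreeBM τ F W) {h : ℝ}
    (hh : 0 ≤ h) {k : ℕ} {x d : Matrix (Fin n) (Fin n) A} (hx : x ∈ overAlg n (F (k * h)))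
    (hd : d = (n : ℂ)⁻¹ • (gridNoise W h k * gridNoise W h k) - (h : ℂ) • 1) :
    norm2 (normTrace τ) (star x * d * x) ^ 2 = h ^ 2 * norm2 (normTrace τ) x ^ 4 := by
  have hb : IsBoundedTrace (normTrace τ : Matrix (Fin n) (Fin n) A →ₗ[ℂ] ℂ) :=
    hτ.isBoundedTrace_normTrace
  have hn : (n : ℂ) ≠ 0 := by simp [NeZero.ne n]
  have hsemi := hW.gridNoise_semicircular hh k
  have hmem := mem_matrix_entryAlg (gridNoise W h k)
  have hdmem : d ∈ (entryAlg (gridNoise W h k)).toSubalgebra.matrix := by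
    rw [hd]
    exact sub_mem (Subalgebra.smul_mem _ (mul_mem hmem hmem) _)
      (Subalgebra.smul_mem _ (one_mem _) _)
  have hd0 : expect τ d = 0 := by
    rw [hd, map_sub, map_smul, map_smul, hsemi.expect_mul_self, expect_one hτ.map_one, smul_smul,
      inv_mul_cancel_left₀ hn, sub_self]
  have hdstar : star d = d := by
    rw [hd, star_sub, star_smul, star_smul, star_mul, hW.star_gridNoise hh]
    simp
  have e := normTrace_mul_four_of_free hτ.map_one (hW.gridNoise_free hh k)
    (mul_mem hx (star_mem_overAlg hx)) hdmem hd0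
  simp only [hsemi.map_sq_entry_mul hτ.map_one hd] at e
  -- The covariance of `d` keeps only j = i and k = l; the remaining double sum is a product of two
  -- traces, and the powers of `n` cancel.
  have e' : normTrace τ (x * star x * d * (x * star x) * d) =
      (h : ℂ) ^ 2 * normTrace τ (x * star x) ^ 2 := by
    rw [e, normTrace_apply]
    have : ∀ i l : Fin n, ∑ k, ∑ j, τ ((x * star x) i j) * τ ((x * star x) k l) *
        (if j = i ∧ k = l then (h : ℂ) ^ 2 / n else 0) =
        τ ((x * star x) i i) * τ ((x * star x) l l) * ((h : ℂ) ^ 2 / n) := by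
      intro i l
      rw [Finset.sum_eq_single l, Finset.sum_eq_single i]
      · simp
      · intro b _ hb; simp [hb]
      · simp
      · intro b _ hb; simp [hb]
      · simp
    simp only [this, ← Finset.sum_mul, ← Finset.mul_sum]
    field_simp
  rw [hb.norm2_sq]
  have e2 : normTrace τ (star (star x * d * x) * (star x * d * x)) =
      ((h ^ 2 * (norm2 (normTrace τ) x ^ 2) ^ 2 : ℝ) : ℂ) := by
    rw [Complex.ofReal_mul, Complex.ofReal_pow _ 2, Complex.ofReal_pow _ 2, hb.ofReal_norm2_sq,
      hb.tracial (star x) x, ← e', star_mul, star_mul, star_star, hdstar]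
    have e3 : star x * (d * x) * (star x * d * x) = star x * (d * (x * star x) * d * x) := by
      simp only [mul_assoc]
    rw [e3, hb.tracial, hb.tracial (x * star x * d * (x * star x)) d]
    have e4 : d * (x * star x) * d * x * star x = d * (x * star x * d * (x * star x)) := by
      simp only [mul_assoc]
    rw [e4]
  rw [e2, Complex.ofReal_re]
  ring

/-- The Euler scheme is nearly unitary. -/
theorem IsMatrixFreeBM.euler_nearly_unitary [NeZero n] (hτ : IsTracialState τ)
    (hF : ∀ s t, 0 ≤ s → s ≤ t → F s ≤ F t) (hW : IsMatrixFreeBM τ F W) {h : ℝ} (hh : 0 ≤ h)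
    (k : ℕ) :
    normTrace τ (star (euler W h k) * euler W h k) = (((1 + h ^ 2 / 4) ^ k : ℝ) : ℂ) ∧
    norm2 (normTrace τ) (star (euler W h k) * euler W h k -
      (((1 + h ^ 2 / 4) ^ k : ℝ) : ℂ) • 1) ^ 2 ≤ k * h ^ 2 * ((1 + h ^ 2 / 4) ^ k) ^ 2 := by
  have hb : IsBoundedTrace (normTrace τ : Matrix (Fin n) (Fin n) A →ₗ[ℂ] ℂ) :=
    hτ.isBoundedTrace_normTrace
  have hn : (n : ℂ) ≠ 0 := by simp [NeZero.ne n]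
  induction k with
  | zero => simp [euler, hb.map_one, norm2_zero]
  | succ k ih =>
    obtain ⟨ih1, ih2⟩ := ih
    set x := euler W h k with hx
    set γ : ℝ := 1 + h ^ 2 / 4 with hγ
    set d := (n : ℂ)⁻¹ • (gridNoise W h k * gridNoise W h k) - (h : ℂ) • 1 with hd
    have hγ1 : 1 ≤ γ := by rw [hγ]; nlinarith [sq_nonneg h]
    have hsucc := euler_star_mul_self_succ hW hh k
    rw [← hx, ← hγ, ← hd] at hsucc
    have hxmem : x ∈ overAlg n (F (k * h)) := hW.euler_mem hF hh k
    have hmem := mem_matrix_entryAlg (gridNoise W h k)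
    have hdmem : d ∈ (entryAlg (gridNoise W h k)).toSubalgebra.matrix :=
      sub_mem (Subalgebra.smul_mem _ (mul_mem hmem hmem) _)
        (Subalgebra.smul_mem _ (one_mem _) _)
    have hd0 : expect τ d = 0 := by
      rw [hd, map_sub, map_smul, map_smul, (hW.gridNoise_semicircular hh k).expect_mul_self,
        expect_one hτ.map_one, smul_smul, inv_mul_cancel_left₀ hn, sub_self]
    -- The new fluctuation is orthogonal to the past, so squared L² norms add up over the steps.
    have hcent : ∀ a ∈ overAlg n (F (k * h)), normTrace τ (a * (star x * d * x)) = 0 := by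
      intro a ha
      have e : a * (star x * d * x) = a * star x * d * x := by simp only [mul_assoc]
      rw [e, hb.tracial, ← mul_assoc]
      exact normTrace_mul_centred_of_free hτ.map_one (hW.gridNoise_free hh k)
        (mul_mem hxmem (mul_mem ha (star_mem_overAlg hxmem))) hdmem hd0
    refine ⟨?_, ?_⟩
    · have := hcent 1 (one_mem _)
      rw [one_mul] at this
      rw [hsucc, map_add, map_smul, ih1, this, add_zero, pow_succ', Complex.ofReal_mul,
        smul_eq_mul]
    · set y := star x * x - ((γ ^ k : ℝ) : ℂ) • (1 : Matrix (Fin n) (Fin n) A) with hy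
      have hsplit : star (euler W h (k + 1)) * euler W h (k + 1) - ((γ ^ (k + 1) : ℝ) : ℂ) • 1 =
          (γ : ℂ) • y + star x * d * x := by
        rw [hsucc, hy, smul_sub, smul_smul, pow_succ' γ k, Complex.ofReal_mul]
        abel
      have hymem : y ∈ overAlg n (F (k * h)) :=
        sub_mem (mul_mem (star_mem_overAlg hxmem) hxmem) (Subalgebra.smul_mem _ (one_mem _) _)
      rw [hsplit, hb.norm2_add_sq, hb.norm2_smul, norm2_fluctuation hτ hW hh hxmem hd]
      · have hx4 : norm2 (normTrace τ) x ^ 4 = (γ ^ k) ^ 2 := by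
          have : norm2 (normTrace τ) x ^ 2 = γ ^ k := by
            rw [hb.norm2_sq, ih1, Complex.ofReal_re]
          rw [← this]; ring
        rw [hx4, Complex.norm_real, Real.norm_of_nonneg (by linarith)]
        have h1 : 0 ≤ h ^ 2 * (γ ^ k) ^ 2 := by positivity
        have h2 : 1 ≤ γ ^ 2 := one_le_pow₀ hγ1
        push_cast
        rw [pow_succ γ k]
        calc (γ * norm2 (normTrace τ) y) ^ 2 + h ^ 2 * (γ ^ k) ^ 2
            ≤ γ ^ 2 * (k * h ^ 2 * (γ ^ k) ^ 2) + γ ^ 2 * (h ^ 2 * (γ ^ k) ^ 2) := by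
              rw [mul_pow]
              exact add_le_add (mul_le_mul_of_nonneg_left ih2 (by positivity))
                (le_mul_of_one_le_left h1 h2)
          _ = _ := by ring
      · rw [star_smul]
        rw [smul_mul_assoc, map_smul, hcent _ (star_mem_overAlg hymem), smul_zero]

-- A weak form of unitarity that needs no faithfulness. With only L² convergence of the scheme, U*U
-- - V*V is not controlled in L², but its trace against a fixed `x` is, by Cauchy-Schwarz and the L²
-- boundedness of multiplication by `x`.
open Filter Topology in
theorem IsFreeUnitaryBM.normTrace_mul_star_mul_self_sub_one [NeZero n] (hτ : IsTracialState τ)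
    (hU : IsFreeUnitaryBM τ F W U) {T : ℝ} (hT : 0 ≤ T) (x : Matrix (Fin n) (Fin n) A) :
    normTrace τ (x * (star (U T) * U T - 1)) = 0 := by
  have hb : IsBoundedTrace (normTrace τ : Matrix (Fin n) (Fin n) A →ₗ[ℂ] ℂ) :=
    hτ.isBoundedTrace_normTrace
  obtain ⟨K, hK, hKx⟩ := hb.norm2_mul_le_right x
  set V : ℕ → Matrix (Fin n) (Fin n) A := fun N => euler W (T / N) N with hV
  set γ : ℕ → ℝ := fun N => (1 + (T / N) ^ 2 / 4) ^ N with hγ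
  set e : ℕ → ℝ := fun N => norm2 (normTrace τ) (U T - V N) with he
  set y : ℕ → ℝ := fun N => norm2 (normTrace τ)
    (star (V N) * V N - (γ N : ℂ) • (1 : Matrix (Fin n) (Fin n) A)) with hy
  have hbound : ∀ N, ‖normTrace τ (x * (star (U T) * U T - 1))‖ ≤
      norm2 (normTrace τ) (x * star (U T)) * e N + norm2 (normTrace τ) (U T * x) * e N +
        K * e N * e N + norm2 (normTrace τ) x * y N + ‖(γ N : ℂ) - 1‖ * ‖normTrace τ x‖ := by
    intro N
    have hsplit : x * (star (U T) * U T - 1) = x * star (U T) * (U T - V N) +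
        x * star (U T - V N) * U T - x * star (U T - V N) * (U T - V N) +
        x * (star (V N) * V N - (γ N : ℂ) • 1) + ((γ N : ℂ) - 1) • x := by
      simp only [star_sub, mul_sub, sub_mul, mul_smul_comm, mul_one, sub_smul, one_smul, mul_assoc]
      abel
    have h1 := hb.norm_map_mul_le (x * star (U T)) (U T - V N)
    have h2 : ‖normTrace τ (x * star (U T - V N) * U T)‖ ≤
        norm2 (normTrace τ) (U T * x) * e N := by
      rw [hb.tracial, ← mul_assoc, he]
      simpa only [hb.norm2_star] using hb.norm_map_mul_le (U T * x) (star (U T - V N))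
    have h3 : ‖normTrace τ (x * star (U T - V N) * (U T - V N))‖ ≤ K * e N * e N := by
      rw [hb.tracial, ← mul_assoc]
      refine (hb.norm_map_mul_le _ _).trans ?_
      rw [hb.norm2_star]
      exact mul_le_mul_of_nonneg_right (hKx _) (norm2_nonneg _ _)
    have h4 := hb.norm_map_mul_le x (star (V N) * V N - (γ N : ℂ) • 1)
    rw [hsplit, map_add, map_add, map_sub, map_add, map_smul, smul_eq_mul]
    refine (norm_add_le _ _).trans (add_le_add ?_ (norm_mul_le _ _))
    refine (norm_add_le _ _).trans (add_le_add ?_ h4)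
    refine (norm_sub_le _ _).trans (add_le_add ?_ h3)
    exact (norm_add_le _ _).trans (add_le_add h1 h2)
  -- The growth factor over all N steps is at most exp(T²/(4N)).
  have hγ1 : Tendsto γ atTop (𝓝 1) := by
    have hup : Tendsto (fun N : ℕ => Real.exp (T ^ 2 / 4 / N)) atTop (𝓝 1) := by
      rw [← Real.exp_zero]
      exact (Real.continuous_exp.tendsto 0).comp (tendsto_const_div_atTop_nhds_zero_nat _)
    refine tendsto_of_tendsto_of_tendsto_of_le_of_le' tendsto_const_nhds hup
      (Eventually.of_forall fun N => ?_) ?_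
    · exact one_le_pow₀ (by have := sq_nonneg (T / N); linarith)
    · filter_upwards [eventually_gt_atTop 0] with N hN
      have hN' : (N : ℝ) ≠ 0 := Nat.cast_ne_zero.2 hN.ne'
      calc (1 + (T / N) ^ 2 / 4) ^ N ≤ Real.exp ((T / N) ^ 2 / 4) ^ N := by
            gcongr
            rw [add_comm]; exact Real.add_one_le_exp _
        _ = Real.exp (T ^ 2 / 4 / N) := by
            rw [← Real.exp_nat_mul]; congr 1; field_simp
  have he0 : Tendsto e atTop (𝓝 0) := hU.tendsto_euler hτ hT
  have hy0 : Tendsto y atTop (𝓝 0) := by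
    have hsq : Tendsto (fun N : ℕ => T ^ 2 / N * γ N ^ 2) atTop (𝓝 0) := by
      simpa using (tendsto_const_div_atTop_nhds_zero_nat (T ^ 2)).mul (hγ1.pow 2)
    have hsqrt : Tendsto (fun N : ℕ => √(T ^ 2 / N * γ N ^ 2)) atTop (𝓝 0) := by
      simpa using hsq.sqrt
    refine tendsto_of_tendsto_of_tendsto_of_le_of_le' tendsto_const_nhds hsqrt
      (Eventually.of_forall fun N => norm2_nonneg _ _) ?_
    filter_upwards [eventually_gt_atTop 0] with N hN
    have hN' : (N : ℝ) ≠ 0 := Nat.cast_ne_zero.2 hN.ne'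
    refine Real.le_sqrt_of_sq_le ?_
    have := (hU.noise.euler_nearly_unitary hτ hU.filtration
      (div_nonneg hT (Nat.cast_nonneg N)) N).2
    refine this.trans (le_of_eq ?_)
    simp only [hγ]
    field_simp
  have hlim : Tendsto (fun N => norm2 (normTrace τ) (x * star (U T)) * e N +
      norm2 (normTrace τ) (U T * x) * e N + K * e N * e N + norm2 (normTrace τ) x * y N +
      ‖(γ N : ℂ) - 1‖ * ‖normTrace τ x‖) atTop (𝓝 0) := by
    have hγ2 : Tendsto (fun N => ‖(γ N : ℂ) - 1‖) atTop (𝓝 0) := by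
      have := ((Complex.continuous_ofReal.tendsto 1).comp hγ1).sub_const 1
      simpa using this.norm
    simpa using ((((he0.const_mul (norm2 (normTrace τ) (x * star (U T)))).add
      (he0.const_mul (norm2 (normTrace τ) (U T * x)))).add ((he0.const_mul K).mul he0)).add
      (hy0.const_mul (norm2 (normTrace τ) x))).add (hγ2.mul_const ‖normTrace τ x‖)
  exact norm_le_zero_iff.1 (ge_of_tendsto' hlim hbound)

theorem IsFaithful.normTrace_star_mul_self_eq_zero [NeZero n] (hτ : IsTracialState τ)
    (hf : IsFaithful τ) {x : Matrix (Fin n) (Fin n) A} (hx : normTrace τ (star x * x) = 0) :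
    x = 0 := by
  have h1 : (normTrace τ (star x * x)).re = 0 := by rw [hx, Complex.zero_re]
  rw [hτ.re_normTrace, mul_eq_zero, or_iff_right (by simp [NeZero.ne n])] at h1
  have h2 := (Finset.sum_eq_zero_iff_of_nonneg fun i _ =>
    Finset.sum_nonneg fun j _ => sq_nonneg _).1 h1
  ext i j
  have h3 := (Finset.sum_eq_zero_iff_of_nonneg fun j _ => sq_nonneg _).1
    (h2 i (Finset.mem_univ i)) j (Finset.mem_univ j)
  refine hf _ ?_
  rw [← hτ.isBoundedTrace.ofReal_norm2_sq, h3, Complex.ofReal_zero]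

/-- The free unitary Brownian motion is unitary if the trace is faithful. -/
theorem IsFreeUnitaryBM.mem_unitary [NeZero n] (hτ : IsTracialState τ)
    (hU : IsFreeUnitaryBM τ F W U) (hf : IsFaithful τ) {T : ℝ} (hT : 0 ≤ T) :
    U T ∈ unitary (Matrix (Fin n) (Fin n) A) := by
  have hb : IsBoundedTrace (normTrace τ : Matrix (Fin n) (Fin n) A →ₗ[ℂ] ℂ) :=
    hτ.isBoundedTrace_normTrace
  have h1 : star (U T) * U T = 1 := sub_eq_zero.1 <| hf.normTrace_star_mul_self_eq_zero hτ <|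
    hU.normTrace_mul_star_mul_self_sub_one hτ hT _
  -- Since U*U = 1, the element 1 - UU* is a projection, and traciality makes its trace zero.
  have h2 : U T * star (U T) = 1 := by
    refine sub_eq_zero.1 (hf.normTrace_star_mul_self_eq_zero hτ ?_)
    have e : star (U T * star (U T) - 1) * (U T * star (U T) - 1) = 1 - U T * star (U T) := by
      have e2 : U T * star (U T) * (U T * star (U T)) = U T * star (U T) := by
        rw [mul_assoc, ← mul_assoc (star (U T)), h1, one_mul]
      rw [star_sub, star_mul, star_star, star_one, sub_mul, mul_sub, e2]
      simp
    rw [e, map_sub, hb.tracial (U T), h1, sub_self]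
  exact ⟨h1, h2⟩

end Unitarity

/-! ### Conjugation by a free unitary -/

section Conjugation

variable {M : Type*} [Ring M] [Algebra ℂ M] {φ : M →ₗ[ℂ] ℂ}

theorem FreeFamily.swap {C D : Subalgebra ℂ M} (h : FreeFamily φ (pair C D)) :
    FreeFamily φ (pair D C) := fun i j x hx =>
  h (!i) (!j) x (hx.map (Y := fun i => centred φ (pair C D i)) not
    (fun a b => by cases a <;> cases b <;> simp) id (fun _ _ => rfl)
    fun i x hx => by cases i <;> exact hx)

/-- Conjugation by an invertible element. -/
def conjHom (v v' : M) (h : v' * v = 1) (h' : v * v' = 1) : M →ₐ[ℂ] M :=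
  AlgHom.ofLinearMap ((LinearMap.mulLeft ℂ v) ∘ₗ (LinearMap.mulRight ℂ v')) (by simp [h'])
    fun x y => by
      simp only [LinearMap.comp_apply, LinearMap.mulLeft_apply, LinearMap.mulRight_apply]
      calc v * (x * y * v') = v * x * 1 * y * v' := by simp only [mul_assoc, one_mul]
        _ = _ := by rw [← h]; simp only [mul_assoc]

theorem conjHom_apply (v v' : M) (h : v' * v = 1) (h' : v * v' = 1) (x : M) :
    conjHom v v' h h' x = v * (x * v') := rfl

/-- The pairs `(x, x')` of a noncommutative polynomial in elements of `C` and `D` and the same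
polynomial with `v C v⁻¹` in place of `C`. -/
def conjPairs (C D : Subalgebra ℂ M) (f : M →ₐ[ℂ] M) : Subalgebra ℂ (M × M) :=
  ⨆ b, pair (C.map ((AlgHom.id ℂ M).prod f)) (D.map ((AlgHom.id ℂ M).prod (AlgHom.id ℂ M))) b

/-- If `C` is free from an algebra that contains `v` and `D`, then the joint laws of `(C, D)` and
`(v C v⁻¹, D)` agree. -/
theorem map_eq_of_mem_conjPairs (h1 : φ 1 = 1) (hφ : ∀ a b, φ (a * b) = φ (b * a))
    {C D N : Subalgebra ℂ M} (hCN : FreeFamily φ (pair C N)) (hD : D ≤ N) {v v' : M} (hv : v ∈ N)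
    (hv' : v' ∈ N) (h : v' * v = 1) (h' : v * v' = 1) {z : M × M}
    (hz : z ∈ conjPairs C D (conjHom v v' h h')) : φ z.1 = φ z.2 := by
  have hconj : ∀ x, φ (v' * (x * v)) = φ x := fun x => by
    rw [hφ, mul_assoc, h', mul_one]
  -- Working with pairs lets one decomposition into alternating words serve both polynomials.
  -- Centring with respect to the first component also centres the second, as conjugation preserves
  -- `φ`.
  have hspan := iSup_le_span_altWord (φ := φ ∘ₗ LinearMap.fst ℂ M M) h1 _ hz
  suffices hle : Submodule.span ℂ ({1} ∪ {y | ∃ i j, AltWord (fun i => centred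
      (φ ∘ₗ LinearMap.fst ℂ M M) (pair (C.map ((AlgHom.id ℂ M).prod (conjHom v v' h h')))
        (D.map ((AlgHom.id ℂ M).prod (AlgHom.id ℂ M))) i)) i j y}) ≤
      LinearMap.ker (φ ∘ₗ LinearMap.fst ℂ M M - φ ∘ₗ LinearMap.snd ℂ M M) from
    sub_eq_zero.1 (hle hspan)
  refine Submodule.span_le.2 ?_
  rintro z (rfl | ⟨i, j, hw⟩)
  · exact sub_self _
  · have e1 : φ z.1 = 0 := by
      refine hCN i j _ (hw.map (Y := fun b => centred φ (pair C N b)) id Function.injective_id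
        Prod.fst (fun _ _ => rfl) ?_)
      rintro (_ | _) x ⟨⟨y, hy, rfl⟩, hx0⟩
      · exact ⟨hD hy, hx0⟩
      · exact ⟨hy, hx0⟩
    -- Conjugating back sends v c v⁻¹ to c and d to v⁻¹ d v, which still lies in `N` and is still
    -- centred.
    have e2 : φ (v' * (z.2 * v)) = 0 := by
      refine hCN i j _ (hw.map (Y := fun b => centred φ (pair C N b)) id Function.injective_id
        (fun z : M × M => v' * (z.2 * v)) ?_ ?_)
      · intro x y
        change v' * (x.2 * y.2 * v) = v' * (x.2 * v) * (v' * (y.2 * v))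
        calc v' * (x.2 * y.2 * v) = v' * x.2 * 1 * y.2 * v := by simp only [mul_assoc, one_mul]
          _ = _ := by rw [← h']; simp only [mul_assoc]
      · rintro (_ | _) x ⟨⟨y, hy, rfl⟩, hx0⟩
        · exact ⟨mul_mem hv' (mul_mem (hD hy) hv), (hconj y).trans hx0⟩
        · have e : v' * (v * (y * v') * v) = y := by
            calc v' * (v * (y * v') * v) = (v' * v) * y * (v' * v) := by simp only [mul_assoc]
              _ = y := by rw [h, one_mul, mul_one]
          change v' * (v * (y * v') * v) ∈ centred φ C
          rw [e]
          exact ⟨hy, hx0⟩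
    rw [hconj] at e2
    change φ z.1 - φ z.2 = 0
    rw [e1, e2, sub_self]

end Conjugation

/-! ### From freeness of matrices to the law of the entries -/

section Final

variable {A : Type*} [CStarAlgebra A] {n : ℕ} {τ : A →ₗ[ℂ] ℂ}
  {F : ℝ → StarSubalgebra ℂ A} {W U : ℝ → Matrix (Fin n) (Fin n) A}

/-- The algebra generated by the free unitary Brownian motion at a fixed time and its adjoint is
free from the scalar matrices. -/
theorem IsFreeUnitaryBM.freeFamily_scalars [NeZero n] (hτ : IsTracialState τ)
    (hU : IsFreeUnitaryBM τ F W U) {T : ℝ} (hT : 0 ≤ T) :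
    FreeFamily (normTrace τ) (pair (Algebra.adjoin ℂ {U T, star (U T)}) (scalars A n)) := by
  have hb : IsBoundedTrace (normTrace τ : Matrix (Fin n) (Fin n) A →ₗ[ℂ] ℂ) :=
    hτ.isBoundedTrace_normTrace
  have hmem : U T ∈ hb.l2Closure (⨆ m, dyadicAlg W T m) := by
    intro ε hε
    -- Along N = 2^m the grid is dyadic, so the scheme takes its values in `dyadicAlg`.
    have hlim := (hU.tendsto_euler hτ hT).comp
      (tendsto_pow_atTop_atTop_of_one_lt (one_lt_two : 1 < 2))
    obtain ⟨m, hm⟩ := (hlim.eventually (gt_mem_nhds hε)).exists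
    refine ⟨_, le_iSup (dyadicAlg W T) m ?_, hm⟩
    have := euler_mem_adjoin W (T / (2 ^ m : ℕ)) (le_refl (2 ^ m))
    simpa only [dyadicAlg, Nat.cast_pow, Nat.cast_ofNat] using this
  have hstar : ∀ c ∈ ⨆ m, dyadicAlg W T m, star c ∈ ⨆ m, dyadicAlg W T m := by
    intro c hc
    rw [← SetLike.mem_coe, Subalgebra.coe_iSup_of_directed (dyadicAlg_mono W T).directed_le,
      Set.mem_iUnion] at hc
    obtain ⟨m, hm⟩ := hc
    exact le_iSup (dyadicAlg W T) m (star_mem_dyadicAlg hU.noise hT m hm)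
  refine (hb.freeFamily_l2Closure (hU.noise.freeFamily_dyadic hτ hU.filtration hT)).mono_left
    (Algebra.adjoin_le ?_)
  rintro x (rfl | rfl)
  exacts [hmem, hb.star_mem_l2Closure hstar hmem]

theorem const_single (i j : Fin n) :
    const (A := A) (Matrix.single i j 1) = Matrix.single i j 1 := by
  ext a b
  rw [const_apply, Matrix.single_apply, Matrix.single_apply]
  split_ifs <;> simp

/-- Sandwiching a matrix between matrix units moves its entry (i, j) to position (a, b). Entries of
`P` and `Q`, and then all polynomials in them, thus become the same polynomial in `P` or `Q`, their
adjoints and scalar matrices. -/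
theorem single_eval_mem_conjPairs {v : Matrix (Fin n) (Fin n) A} {h : star v * v = 1}
    {h' : v * star v = 1} (P Q : unitary (Matrix (Fin n) (Fin n) A))
    (hPQ : (Q : Matrix (Fin n) (Fin n) A) = conjHom v (star v) h h' P)
    (u : DualVoiculescu n) (a b : Fin n) :
    ((Matrix.single a b (DualVoiculescu.eval P u), Matrix.single a b (DualVoiculescu.eval Q u)) :
      Matrix (Fin n) (Fin n) A × Matrix (Fin n) (Fin n) A) ∈
      conjPairs (Algebra.adjoin ℂ {P.1, star P.1}) (scalars A n) (conjHom v (star v) h h') := by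
  set f := conjHom v (star v) h h' with hf
  set S := conjPairs (Algebra.adjoin ℂ {P.1, star P.1}) (scalars A n) f with hS
  have hD : ∀ m : Matrix (Fin n) (Fin n) ℂ, (const (A := A) m, const (A := A) m) ∈ S := fun m =>
    le_iSup (pair ((Algebra.adjoin ℂ {P.1, star P.1}).map ((AlgHom.id ℂ _).prod f))
      ((scalars A n).map ((AlgHom.id ℂ _).prod (AlgHom.id ℂ _)))) false ⟨const m, ⟨m, rfl⟩, rfl⟩
  have hC : ∀ x ∈ Algebra.adjoin ℂ {P.1, star P.1}, (x, f x) ∈ S := fun x hx =>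
    le_iSup (pair ((Algebra.adjoin ℂ {P.1, star P.1}).map ((AlgHom.id ℂ _).prod f))
      ((scalars A n).map ((AlgHom.id ℂ _).prod (AlgHom.id ℂ _)))) true ⟨x, hx, rfl⟩
  have hQ : star Q.1 = f (star P.1) := by
    rw [hPQ, hf, conjHom_apply, conjHom_apply, star_mul, star_mul, star_star, mul_assoc]
  have hentry : ∀ x ∈ Algebra.adjoin ℂ {P.1, star P.1}, ∀ i j a b,
      ((Matrix.single a b (x i j), Matrix.single a b (f x i j)) :
        Matrix (Fin n) (Fin n) A × Matrix (Fin n) (Fin n) A) ∈ S := by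
    intro x hx i j a b
    have := mul_mem (mul_mem (hD (Matrix.single a i 1)) (hC x hx)) (hD (Matrix.single j b 1))
    simpa [const_single, Matrix.single_mul_mul_single] using this
  induction u using DualVoiculescu.induction generalizing a b with
  | hc c =>
    have := hD (c • Matrix.single a b 1)
    rw [map_smul, const_single, Matrix.smul_single, ← Algebra.algebraMap_eq_smul_one] at this
    rwa [AlgHomClass.commutes, AlgHomClass.commutes]
  | hg x =>
    obtain ⟨i, j, s⟩ := x
    -- The adjoint generator evaluates to an entry of the adjoint matrix, with the indices
    -- exchanged.
    have hgen : ∀ R : unitary (Matrix (Fin n) (Fin n) A),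
        DualVoiculescu.eval R (DualVoiculescu.gen (i, j, s)) =
          if s then star R.1 j i else R.1 i j := fun R => DualVoiculescu.evalAlg_gen R (i, j, s)
    rw [hgen, hgen, hQ, hPQ]
    cases s
    · exact hentry _ (Algebra.subset_adjoin (Or.inl rfl)) i j a b
    · exact hentry _ (Algebra.subset_adjoin (Or.inr rfl)) j i a b
  | hm x y hx hy =>
    have := mul_mem (hx a b) (hy b b)
    simpa using this
  | ha x y hx hy =>
    have := add_mem (hx a b) (hy a b)
    simpa [Matrix.single_add] using this

end Final

end FreeProb

theorem mainTheorem9 {A : Type*} [CStarAlgebra A] (τ : A →ₗ[ℂ] ℂ)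
    (hτ : FreeProb.IsTracialState τ) (n : ℕ) (hn : 1 ≤ n)
    (F : ℝ → StarSubalgebra ℂ A) (W U : ℝ → Matrix (Fin n) (Fin n) A)
    (hU : FreeProb.IsFreeUnitaryBM τ F W U)
    (V : unitary (Matrix (Fin n) (Fin n) A)) (t : ℝ) (ht : 0 ≤ t)
    (hV : FreeProb.IsFreePair τ (FreeProb.entryAlg (V : Matrix (Fin n) (Fin n) A))
      (FreeProb.entryAlg (U t))) :
    (FreeProb.IsFaithful τ → U t ∈ unitary (Matrix (Fin n) (Fin n) A)) ∧
      ∀ (hUt : U t ∈ unitary (Matrix (Fin n) (Fin n) A)) (u : DualVoiculescu n),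
        τ (DualVoiculescu.eval (V * ⟨U t, hUt⟩ * V⁻¹) u) =
          τ (DualVoiculescu.eval ⟨U t, hUt⟩ u) := by
  have : NeZero n := ⟨by omega⟩
  refine ⟨fun hf => hU.mem_unitary hτ hf ht, fun hUt u => ?_⟩
  have hUmem := FreeProb.mem_matrix_entryAlg (U t)
  have hVmem := FreeProb.mem_matrix_entryAlg (V : Matrix (Fin n) (Fin n) A)
  -- The algebra of `U t` is free from all matrices over the entries of `V`; these contain `V`, its
  -- inverse and the scalars.
  have hfree := FreeProb.freeFamily_matrix hτ.map_one hV.freeFamily.swap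
    (C := Algebra.adjoin ℂ {U t, star (U t)}) (Algebra.adjoin_le (by
      rintro x (rfl | rfl)
      exacts [hUmem, FreeProb.star_mem_overAlg hUmem])) (hU.freeFamily_scalars hτ ht)
  have hpair := FreeProb.single_eval_mem_conjPairs (h := Unitary.star_mul_self_of_mem V.2)
    (h' := Unitary.mul_star_self_of_mem V.2) ⟨U t, hUt⟩ (V * ⟨U t, hUt⟩ * V⁻¹)
    (mul_assoc _ _ _) u 0 0
  have hmain := FreeProb.map_eq_of_mem_conjPairs
    (FreeProb.normTrace_one hτ.map_one) (FreeProb.normTrace_mul_comm hτ.tracial) hfree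
    (FreeProb.scalars_le_matrix _) hVmem (FreeProb.star_mem_overAlg hVmem) _ _ hpair
  -- A single diagonal position suffices to recover `τ` from the matrix trace.
  have hsingle : ∀ x : A, FreeProb.normTrace τ (Matrix.single (0 : Fin n) 0 x) =
      (n : ℂ)⁻¹ * τ x := fun x => by
    simp [FreeProb.normTrace]
  rw [hsingle, hsingle] at hmain
  exact (mul_left_cancel₀ (inv_ne_zero (Nat.cast_ne_zero.2 (NeZero.ne n))) hmain).symm
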